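/- Notation. For $1\le s<\infty$ let $L_s$ be the space of measurable $2\pi$-periodic functions $f:\mathbb R\to\mathbb R$ with $\|f\|_s=\big(\int_0^{2\pi}|f(t)|^s\,dt\big)^{1/s}<\infty$, and let $L_\infty$ be the space of measurable essentially bounded $2\pi$-periodic functions with $\|f\|_\infty=\operatorname{ess\,sup}_t|f(t)|$. For $\alpha>0$, $r>0$, $\beta\in\mathbb R$ put $$P_{\alpha,r,\beta}(t)=\sum_{k=1}^{\infty}e^{-\alpha k^r}\cos\Big(kt-\frac{\beta\pi}{2}\Big),$$ and let $C^{\alpha,r}_{\beta,p}$ be the set of all functions $$f(x)=\frac{a_0}{2}+\frac1\pi\int_{-\pi}^{\pi}P_{\alpha,r,\beta}(x-t)\varphi(t)\,dt,\qquad x\in\mathbb R,$$ with $a_0\in\mathbb R$ and $\varphi\in L_p$, $\|\varphi\|_p\le1$, $\int_0^{2\pi}\varphi(t)\,dt=0$. For $n\ge1$ let $$\mathcal E_n(C^{\alpha,r}_{\beta,p})_\infty=\sup_{f\in C^{\alpha,r}_{\beta,p}}\|f-S_{n-1}(f)\|_\infty,$$ where $S_{n-1}(f)$ is the partial Fourier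 sum of $f$ of order $n-1$. For $1<p<\infty$ and $0<r<1$ let $n_0(\alpha,r,p)$ be the least positive integer $n$ such that $$\frac{1}{\alpha r}\,\frac1{n^r}+\frac{\alpha r\,p}{n^{1-r}}\le\frac{1}{(3\pi)^3}\cdot\frac{p-1}{p}.$$ Let $F(a,b;c;z)=1+\sum_{k=1}^\infty\frac{(a)_k(b)_k}{(c)_k}\frac{z^k}{k!}$, where $(x)_k=x(x+1)\cdots(x+k-1)$, be the Gauss hypergeometric function. Theorem. Let $0<r<1$, $1<p<\infty$, $\frac1p+\frac1{p'}=1$, $\alpha>0$ and $\beta\in\mathbb R$. Then for every integer $n\ge n_0(\alpha,r,p)$ the quantity $\mathcal E_n(C^{\alpha,r}_{\beta,p})_\infty$ is finite and $$\mathcal E_n(C^{\alpha,r}_{\beta,p})_\infty=e^{-\alpha n^r}n^{\frac{1-r}{p}}\Bigg(\frac{\|\cos t\|_{p'}}{\pi^{1+\frac1{p'}}(\alpha r)^{\frac1p}}\,F^{\frac1{p'}}\Big(\frac12,\frac{3-p'}2;\frac32;1\Big)+\gamma_{n,p}\bigg(\Big(1+\frac{(\alpha r)^{\frac{p'-1}{p}}}{p'-1}\Big)\frac1{n^{\frac{1-r}{p}}}+\frac{p^{\frac1{p'}}}{(\alpha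 r)^{1+\frac1p}}\,\frac1{n^r}\bigg)\Bigg),$$ where the number $\gamma_{n,p}=\gamma_{n,p}(\alpha,r,\beta)$ satisfies $|\gamma_{n,p}|\le(14\pi)^2$. -/

import Mathlib

namespace GenPoisson

/-- The norm of the space `L_s` of `2π`-periodic functions, `1 ≤ s ≤ ∞`:
`(∫_0^{2π} |f|^s)^{1/s}` for `s < ∞`, and the essential supremum for `s = ∞`
(as an extended nonnegative real). -/
noncomputable def periodNorm (f : ℝ → ℝ) (s : ENNReal) : ENNReal :=
  MeasureTheory.eLpNorm f s (MeasureTheory.volume.restrict (Set.Ico 0 (2 * Real.pi)))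

/-- The generalized Poisson kernel
`P_{α,r,β}(t) = ∑_{k ≥ 1} e^{-α k^r} cos (k t - β π / 2)`. -/
noncomputable def poissonKernel (α r β t : ℝ) : ℝ :=
  ∑' k : ℕ, Real.exp (-α * ((k : ℝ) + 1) ^ r) *
    Real.cos (((k : ℝ) + 1) * t - β * Real.pi / 2)

/-- The set `B_p^0`: `2π`-periodic functions `φ ∈ L_p` with `‖φ‖_p ≤ 1` and `φ ⊥ 1`. -/
def unitBallZero (p : ENNReal) : Set (ℝ → ℝ) :=
  {φ | Function.Periodic φ (2 * Real.pi) ∧ MeasureTheory.AEStronglyMeasurable φ ∧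
    periodNorm φ p ≤ 1 ∧ ∫ t in (0 : ℝ)..(2 * Real.pi), φ t = 0}

/-- The class `C^{α,r}_{β,p}` of generalized Poisson integrals
`f(x) = a₀ / 2 + (1 / π) ∫_{-π}^{π} P_{α,r,β}(x - t) φ(t) dt` with `a₀ ∈ ℝ`, `φ ∈ B_p^0`. -/
def poissonClass (α r β : ℝ) (p : ENNReal) : Set (ℝ → ℝ) :=
  {f | ∃ a₀ : ℝ, ∃ φ ∈ unitBallZero p, ∀ x : ℝ,
    f x = a₀ / 2 +
      1 / Real.pi * ∫ t in (-Real.pi)..Real.pi, poissonKernel α r β (x - t) * φ t}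

/-- The Fourier cosine coefficient `a_k(f)`. -/
noncomputable def cosCoeff (f : ℝ → ℝ) (k : ℕ) : ℝ :=
  1 / Real.pi * ∫ t in (-Real.pi)..Real.pi, f t * Real.cos ((k : ℝ) * t)

/-- The Fourier sine coefficient `b_k(f)`. -/
noncomputable def sinCoeff (f : ℝ → ℝ) (k : ℕ) : ℝ :=
  1 / Real.pi * ∫ t in (-Real.pi)..Real.pi, f t * Real.sin ((k : ℝ) * t)

/-- The partial Fourier sum `S_m(f; x)` of order `m`. -/
noncomputable def fourierSum (m : ℕ) (f : ℝ → ℝ) (x : ℝ) : ℝ :=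
  cosCoeff f 0 / 2 + ∑ k ∈ Finset.Icc 1 m,
    (cosCoeff f k * Real.cos ((k : ℝ) * x) + sinCoeff f k * Real.sin ((k : ℝ) * x))

/-- `𝓔_n(C^{α,r}_{β,p})_s`, the supremum of `‖f - S_{n-1}(f)‖_s` over the class
(for `n ≥ 1`). -/
noncomputable def fourierError (n : ℕ) (α r β : ℝ) (p s : ENNReal) : ENNReal :=
  ⨆ f ∈ poissonClass α r β p, periodNorm (fun x => f x - fourierSum (n - 1) f x) s

/-- `n₀(α,r,p)` for `1 < p < ∞`: the least positive integer `n` with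
`1 / (α r n^r) + α r p / n^{1-r} ≤ (p - 1) / ((3π)³ p)`. -/
noncomputable def nZero (α r p : ℝ) : ℕ :=
  sInf {n : ℕ | 1 ≤ n ∧
    1 / (α * r) * (1 / (n : ℝ) ^ r) + α * r * p / (n : ℝ) ^ (1 - r) ≤
      1 / (3 * Real.pi) ^ 3 * ((p - 1) / p)}

end GenPoisson

namespace GenPoisson

open MeasureTheory Set

/-! Write q = p', a = αr n^{r-1}, ε = 1/(αr n^r) = 1/(na), θ = βπ/2. Subtracting the Fourier sum
leaves (1/π) e^{-αn^r} times the convolution of φ with D(t) = Re(e^{i(nt-θ)} K(t)), where K(t) =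
∑_{j≥0} e^{-α((n+j)^r - n^r)} e^{ijt} (`sub_fourierSum_eq`). Hölder's inequality bounds the supremum
above by ‖D‖_q (`fourierError_le`); the work is to compute this norm and to show that it is nearly
attained by functions of mean zero.

D is a fast wave with a slowly varying amplitude. K agrees with the geometric kernel 1/(1 -
e^{-a+it}) up to a relative error a + 2ε (`norm_tailKernel_sub_geomKernel_le`), and freezing that
kernel at the left ends of n blocks of length 2π/n costs a relative error 2πε. The frozen function g
is a pure cosine wave over one full period on each block. Hence ‖g‖_q is exactly the cosine mean
times the norm of the frozen amplitude (`perNorm_modBlock`), and g|g|^{q-2} has mean exactly zero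
(`integral_modBlock_mul_abs_rpow`). The Hölder extremal function of g is therefore admissible and
yields the lower bound ‖g‖_q - ‖D - g‖_q (`le_fourierError`).

For the amplitude, the geometric kernel differs from 1/(a - it) by at most 9 on the period. The norm
of 1/(a - it) becomes, after t = au, a truncated integral of (1+u²)^{-q/2}; over the whole half-line
this integral is the hypergeometric value (`hypergeometric_eq_tailIntegral`). The remainder has
three sources: bounded errors give the 1, the truncation gives (αr)^{(q-1)/p}/(q-1), and the
relative errors of order ε give the n^{-r} term. `abs_sub_le_of_budget` adds them up. -/

/-! ### The hypergeometric value at 1 as an integral. -/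

/-- The coefficients `(b)_k / k!` of the binomial series of `(1 - x) ^ (-b)`. -/
noncomputable def binomCoeff (b : ℝ) (k : ℕ) : ℝ :=
  (ascPochhammer ℝ k).eval b / (k.factorial : ℝ)

lemma binomCoeff_succ (b : ℝ) (k : ℕ) :
    ((k : ℝ) + 1) * binomCoeff b (k + 1) = (b + k) * binomCoeff b k := by
  have h : (k.factorial : ℝ) ≠ 0 := by positivity
  have h' : (k : ℝ) + 1 ≠ 0 := by positivity
  rw [binomCoeff, binomCoeff, ascPochhammer_succ_eval, Nat.factorial_succ]
  push_cast
  field_simp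

lemma hasSum_binomCoeff (b : ℝ) {x : ℝ} (hx : |x| < 1) :
    HasSum (fun k => binomCoeff b k * x ^ k) ((1 - x) ^ (-b)) := by
  have h := (Real.one_div_one_sub_rpow_hasFPowerSeriesOnBall_zero b).hasSum (y := x) (by
    simpa [enorm_eq_nnnorm, ← NNReal.coe_lt_coe] using hx)
  have h1 : (0 : ℝ) ≤ 1 - x := by linarith [abs_lt.1 hx]
  simp only [zero_add, FormalMultilinearSeries.ofScalars_apply_eq, smul_eq_mul] at h
  rw [Real.rpow_neg h1, ← one_div]
  refine h.congr_fun ?_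
  intro k
  have hf : (k.factorial : ℝ) ≠ 0 := by positivity
  have := Ring.factorial_nsmul_multichoose_eq_ascPochhammer b k
  rw [Polynomial.ascPochhammer_smeval_eq_eval, nsmul_eq_mul, Ring.multichoose_eq] at this
  rw [binomCoeff, ← this]
  field_simp

/-- Once b + k ≥ 0, the recursion gives (1-b)|c_k|/(k+1) = |c_k| - |c_{k+1}|, so the series
telescopes and no asymptotics of the coefficients are needed. -/
lemma summable_binomCoeff_div {b : ℝ} (hb : b < 1) :
    Summable fun k : ℕ => |binomCoeff b k| / (2 * k + 1) := by
  obtain ⟨K, hK⟩ := exists_nat_ge (-b)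
  have step : ∀ k ≥ K, |binomCoeff b k| / (k + 1) =
      (|binomCoeff b k| - |binomCoeff b (k + 1)|) / (1 - b) := by
    intro k hk
    have hk' : (K : ℝ) ≤ k := by exact_mod_cast hk
    have h1 : ((k : ℝ) + 1) * |binomCoeff b (k + 1)| = (b + k) * |binomCoeff b k| := by
      rw [← abs_of_nonneg (by positivity : (0 : ℝ) ≤ (k : ℝ) + 1), ← abs_mul, binomCoeff_succ,
        abs_mul, abs_of_nonneg (by linarith : (0 : ℝ) ≤ b + k)]
    have h2 : (0 : ℝ) < 1 - b := by linarith
    have h3 : (0 : ℝ) < (k : ℝ) + 1 := by positivity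
    rw [div_eq_div_iff h3.ne' h2.ne']
    linear_combination h1
  have tail : Summable fun k : ℕ => |binomCoeff b (k + K)| / ((k + K : ℕ) + 1 : ℝ) := by
    refine summable_of_sum_range_le (c := |binomCoeff b K| / (1 - b)) (fun k => by positivity) ?_
    intro m
    have : ∀ m : ℕ, ∑ k ∈ Finset.range m, |binomCoeff b (k + K)| / ((k + K : ℕ) + 1 : ℝ) =
        (|binomCoeff b K| - |binomCoeff b (m + K)|) / (1 - b) := by
      intro m
      induction m with
      | zero => simp
      | succ m ih =>
        rw [Finset.sum_range_succ, ih, step (m + K) (by omega), ← add_div]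
        congr 1
        rw [show m + 1 + K = m + K + 1 by ring]
        ring
    rw [this]
    have h2 : (0 : ℝ) < 1 - b := by linarith
    gcongr
    linarith [abs_nonneg (binomCoeff b (m + K))]
  have all := (summable_nat_add_iff (f := fun k : ℕ => |binomCoeff b k| / ((k : ℝ) + 1)) K).1 tail
  refine all.of_nonneg_of_le (fun k => by positivity) fun k => ?_
  gcongr
  linarith [(Nat.cast_nonneg k : (0 : ℝ) ≤ k)]

lemma integral_Ioo_pow (c : ℝ) (k : ℕ) :
    ∫ x in Ioo (0 : ℝ) 1, c * (x ^ 2) ^ k = c / (2 * k + 1) := by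
  rw [← integral_Ioc_eq_integral_Ioo, ← intervalIntegral.integral_of_le zero_le_one]
  simp_rw [← pow_mul]
  rw [intervalIntegral.integral_const_mul, integral_pow]
  push_cast
  simp [div_eq_mul_inv]

/-- The ratio (1/2)_k/(3/2)_k = 1/(2k+1) is the integral of x^{2k} over (0,1), so F is the binomial
series of (1-x²)^{-b} integrated term by term. The argument 1 lies on the circle of convergence; the
condition b < 1 justifies the interchange. -/
lemma hypergeometric_eq_integral_Ioo {b : ℝ} (hb : b < 1) :
    ordinaryHypergeometric (1 / 2 : ℝ) b (3 / 2) (1 : ℝ) =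
      ∫ x in Ioo (0 : ℝ) 1, (1 - x ^ 2) ^ (-b) := by
  have h := hasSum_integral_of_summable_integral_norm
    (μ := volume.restrict (Ioo (0 : ℝ) 1)) (F := fun (k : ℕ) x => binomCoeff b k * (x ^ 2) ^ k)
    (fun k => (Continuous.integrableOn_Icc (by fun_prop)).mono_set Ioo_subset_Icc_self) (by
      refine (summable_binomCoeff_div hb).congr fun k => ?_
      rw [← integral_Ioo_pow]
      refine setIntegral_congr_fun measurableSet_Ioo fun x hx => ?_
      simp [abs_of_pos hx.1])
  have h2 : ∫ x in Ioo (0 : ℝ) 1, (∑' k, binomCoeff b k * (x ^ 2) ^ k) =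
      ∫ x in Ioo (0 : ℝ) 1, (1 - x ^ 2) ^ (-b) := by
    refine setIntegral_congr_fun measurableSet_Ioo fun x hx => ?_
    refine (hasSum_binomCoeff b ?_).tsum_eq
    rw [abs_of_nonneg (sq_nonneg x)]
    nlinarith [hx.1, hx.2]
  rw [← h2, ← h.tsum_eq, ordinaryHypergeometric_eq_tsum]
  refine tsum_congr fun k => ?_
  rw [integral_Ioo_pow]
  have h3 : ∀ k : ℕ, (ascPochhammer ℝ k).eval (1 / 2) * (2 * k + 1) =
      (ascPochhammer ℝ k).eval (3 / 2) := by
    intro k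
    induction k with
    | zero => simp
    | succ k ih =>
      rw [ascPochhammer_succ_eval, ascPochhammer_succ_eval, ← ih]
      push_cast
      ring
  have h4 : 0 < (ascPochhammer ℝ k).eval (3 / 2 : ℝ) := ascPochhammer_pos k _ (by norm_num)
  have h5 : (2 * k + 1 : ℝ) ≠ 0 := by positivity
  have h6 : (k.factorial : ℝ) ≠ 0 := by positivity
  rw [binomCoeff, one_pow, smul_eq_mul, mul_one]
  have h7 : (ascPochhammer ℝ k).eval (1 / 2 : ℝ) ≠ 0 := (ascPochhammer_pos k _ (by norm_num)).ne'
  rw [← h3 k]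
  field_simp

/-- The integral `∫_0^∞ (1 + u²)^{-q/2} du`. -/
noncomputable def tailIntegral (q : ℝ) : ℝ := ∫ u in Ioi (0 : ℝ), (1 + u ^ 2) ^ (-q / 2)

/-- Substitute x = u/√(1+u²): then 1 - x² = 1/(1+u²) and dx = (1+u²)^{-3/2} du. -/
lemma integral_Ioo_eq_tailIntegral (q : ℝ) :
    ∫ x in Ioo (0 : ℝ) 1, (1 - x ^ 2) ^ (-((3 - q) / 2)) = tailIntegral q := by
  have hpos : ∀ u : ℝ, 0 < 1 + u ^ 2 := fun u => by positivity
  have hsq : ∀ u : ℝ, √(1 + u ^ 2) ^ 2 = 1 + u ^ 2 := fun u => Real.sq_sqrt (hpos u).le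
  have hsp : ∀ u : ℝ, 0 < √(1 + u ^ 2) := fun u => Real.sqrt_pos.2 (hpos u)
  have hone : ∀ u : ℝ, 1 - (u / √(1 + u ^ 2)) ^ 2 = (1 + u ^ 2)⁻¹ := by
    intro u
    rw [div_pow, hsq]
    have := (hpos u).ne'
    field_simp
    ring
  have hd : ∀ u ∈ Ioi (0 : ℝ), HasDerivWithinAt (fun u : ℝ => u / √(1 + u ^ 2))
      ((1 + u ^ 2) ^ (-(3 / 2) : ℝ)) (Ioi 0) u := by
    intro u _
    have h1 : HasDerivAt (fun u : ℝ => √(1 + u ^ 2)) (2 * u / (2 * √(1 + u ^ 2))) u := by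
      have : HasDerivAt (fun u : ℝ => 1 + u ^ 2) (2 * u) u := by
        simpa using (hasDerivAt_pow 2 u).const_add 1
      exact this.sqrt (hpos u).ne'
    have h2 := (hasDerivAt_id u).div h1 (hsp u).ne'
    refine HasDerivAt.hasDerivWithinAt (h2.congr_deriv ?_)
    have h3 : (1 + u ^ 2) ^ (-(3 / 2) : ℝ) = ((1 + u ^ 2) * √(1 + u ^ 2))⁻¹ := by
      rw [Real.rpow_neg (hpos u).le, Real.sqrt_eq_rpow]
      congr 1
      rw [← Real.rpow_one_add' (hpos u).le (by norm_num)]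
      norm_num
    rw [h3, ← hsq u]
    have := (hsp u).ne'
    simp only [id]
    rw [Real.sqrt_sq (hsp u).le]
    field_simp
    linear_combination hsq u
  have himg : (fun u : ℝ => u / √(1 + u ^ 2)) '' Ioi 0 = Ioo 0 1 := by
    ext x
    constructor
    · rintro ⟨u, hu, rfl⟩
      have hu' : (0 : ℝ) < u := hu
      refine ⟨div_pos hu' (hsp u), ?_⟩
      rw [div_lt_one (hsp u)]
      exact Real.lt_sqrt_of_sq_lt (by linarith)
    · rintro ⟨h0, h1⟩
      have h2 : 0 < 1 - x ^ 2 := by nlinarith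
      have h3 : 0 < √(1 - x ^ 2) := Real.sqrt_pos.2 h2
      refine ⟨x / √(1 - x ^ 2), div_pos h0 h3, ?_⟩
      have h4 : 1 + (x / √(1 - x ^ 2)) ^ 2 = (√(1 - x ^ 2) ^ 2)⁻¹ := by
        rw [div_pow, Real.sq_sqrt h2.le]
        field_simp
        ring
      simp only
      rw [h4, Real.sqrt_inv, Real.sqrt_sq h3.le]
      field_simp
  have hinj : InjOn (fun u : ℝ => u / √(1 + u ^ 2)) (Ioi 0) := by
    intro u hu v hv huv
    have h1 := hone u
    have h2 := hone v
    simp only at huv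
    rw [huv, h2, inv_inj] at h1
    have hu' : (0 : ℝ) < u := hu
    have hv' : (0 : ℝ) < v := hv
    nlinarith
  rw [← himg, integral_image_eq_integral_abs_deriv_smul measurableSet_Ioi hd hinj, tailIntegral]
  refine setIntegral_congr_fun measurableSet_Ioi fun u _ => ?_
  simp only [smul_eq_mul]
  rw [hone, abs_of_pos (Real.rpow_pos_of_pos (hpos u) _), Real.inv_rpow (hpos u).le,
    ← Real.rpow_neg (hpos u).le, ← Real.rpow_add (hpos u)]
  congr 1
  ring

lemma hypergeometric_eq_tailIntegral {q : ℝ} (hq : 1 < q) :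
    ordinaryHypergeometric (1 / 2 : ℝ) ((3 - q) / 2) (3 / 2) (1 : ℝ) = tailIntegral q := by
  rw [hypergeometric_eq_integral_Ioo (by linarith), integral_Ioo_eq_tailIntegral]

/-! ### Bounds for the integral of (1+u²)^{-q/2} and its truncation. -/

lemma integrableOn_one_add_sq_rpow {q : ℝ} (hq : 1 < q) :
    IntegrableOn (fun u : ℝ => (1 + u ^ 2) ^ (-q / 2)) (Ioi 0) := by
  have h := integrable_rpow_neg_one_add_norm_sq (E := ℝ) (μ := volume) (r := q) (by simpa using hq)
  simpa using h.integrableOn (s := Ioi 0)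

lemma continuous_add_sq_rpow {a : ℝ} (ha : 0 < a) (s : ℝ) :
    Continuous fun t : ℝ => (a ^ 2 + t ^ 2) ^ s :=
  (by fun_prop : Continuous fun t : ℝ => a ^ 2 + t ^ 2).rpow_const
    fun t => Or.inl (by positivity)

lemma one_add_sq_rpow_le {q : ℝ} (hq : 0 ≤ q) {u : ℝ} (hu : 0 < u) :
    (1 + u ^ 2) ^ (-q / 2) ≤ u ^ (-q) := by
  have h : u ^ (-q) = (u ^ 2) ^ (-q / 2) := by
    rw [← Real.rpow_natCast, ← Real.rpow_mul hu.le]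
    congr 1
    push_cast
    ring
  rw [h]
  exact Real.rpow_le_rpow_of_nonpos (by positivity) (by linarith) (by linarith)

lemma integral_Ioi_one_add_sq_rpow_le {q c : ℝ} (hq : 1 < q) (hc : 0 < c) :
    ∫ u in Ioi c, (1 + u ^ 2) ^ (-q / 2) ≤ c ^ (1 - q) / (q - 1) := by
  have h : ∫ u in Ioi c, u ^ (-q) = c ^ (1 - q) / (q - 1) := by
    rw [integral_Ioi_rpow_of_lt (by linarith) hc, ← neg_div_neg_eq, neg_neg]
    congr 1
    · congr 1
      ring
    · ring
  rw [← h]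
  refine setIntegral_mono_on
    ((integrableOn_one_add_sq_rpow hq).mono_set (Ioi_subset_Ioi hc.le))
    (integrableOn_Ioi_rpow_of_lt (by linarith) hc) measurableSet_Ioi fun u hu => ?_
  exact one_add_sq_rpow_le (by linarith) (hc.trans hu)

lemma tailIntegral_eq_add {q c : ℝ} (hq : 1 < q) (hc : 0 ≤ c) :
    tailIntegral q = (∫ u in (0 : ℝ)..c, (1 + u ^ 2) ^ (-q / 2)) +
      ∫ u in Ioi c, (1 + u ^ 2) ^ (-q / 2) := by
  have h := integrableOn_one_add_sq_rpow hq
  rw [tailIntegral, intervalIntegral.integral_of_le hc, ← setIntegral_union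
    (Ioc_disjoint_Ioi le_rfl) measurableSet_Ioi (h.mono_set Ioc_subset_Ioi_self)
    (h.mono_set (Ioi_subset_Ioi hc)), Ioc_union_Ioi_eq_Ioi hc]

lemma integral_one_add_sq_nonneg (q : ℝ) {c : ℝ} (hc : 0 ≤ c) :
    0 ≤ ∫ u in (0 : ℝ)..c, (1 + u ^ 2) ^ (-q / 2) :=
  intervalIntegral.integral_nonneg hc fun u _ => by positivity

lemma integral_Ioi_one_add_sq_nonneg (q c : ℝ) :
    0 ≤ ∫ u in Ioi c, (1 + u ^ 2) ^ (-q / 2) :=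
  integral_nonneg fun u => by positivity

lemma tailIntegral_le {q : ℝ} (hq : 1 < q) : tailIntegral q ≤ q / (q - 1) := by
  have h1 := integral_Ioi_one_add_sq_rpow_le hq one_pos
  have h2 : ∫ u in (0 : ℝ)..1, (1 + u ^ 2) ^ (-q / 2) ≤ ∫ u in (0 : ℝ)..1, (1 : ℝ) := by
    refine intervalIntegral.integral_mono_on zero_le_one ?_ (by simp) fun u _ => ?_
    · simpa using (continuous_add_sq_rpow one_pos (-q / 2)).intervalIntegrable 0 1
    · exact Real.rpow_le_one_of_one_le_of_nonpos (by nlinarith [sq_nonneg u]) (by linarith)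
  rw [tailIntegral_eq_add hq zero_le_one]
  have h3 : q / (q - 1) = 1 + 1 / (q - 1) := by
    have : q - 1 ≠ 0 := by linarith
    field_simp
    ring
  rw [h3]
  simp at h1 h2 ⊢
  linarith

/-- On [0, 1/q] the integrand is at least e^{-qu²/2} ≥ 1 - qu²/2 ≥ 1/2. This bound permits division
by the integral when q-th roots are compared. -/
lemma le_tailIntegral {q : ℝ} (hq : 1 < q) : 1 / (2 * q) ≤ tailIntegral q := by
  have hc : 0 ≤ 1 / q := by positivity
  rw [tailIntegral_eq_add hq hc]
  have h1 := integral_Ioi_one_add_sq_nonneg q (1 / q)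
  have h2 : ∫ u in (0 : ℝ)..(1 / q), (1 / 2 : ℝ) ≤
      ∫ u in (0 : ℝ)..(1 / q), (1 + u ^ 2) ^ (-q / 2) := by
    refine intervalIntegral.integral_mono_on hc (by simp) ?_ fun u hu => ?_
    · simpa using (continuous_add_sq_rpow one_pos (-q / 2)).intervalIntegrable 0 (1 / q)
    · have h3 : (Real.exp (u ^ 2)) ^ (-q / 2) ≤ (1 + u ^ 2) ^ (-q / 2) :=
        Real.rpow_le_rpow_of_nonpos (by positivity)
          (by linarith [Real.add_one_le_exp (u ^ 2)]) (by linarith)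
      refine le_trans ?_ h3
      rw [← Real.exp_mul]
      have h4 : u * q ≤ 1 := by
        have := (le_div_iff₀ (by linarith : 0 < q)).1 hu.2
        linarith
      have h5 : u ≤ 1 := by nlinarith [hu.1]
      have h6 := Real.add_one_le_exp (u ^ 2 * (-q / 2))
      nlinarith [hu.1]
  simp at h2
  have h7 : 1 / (2 * q) = q⁻¹ * 2⁻¹ := by
    field_simp
  rw [h7]
  simp only [one_div] at *
  linarith

lemma integral_add_sq_rpow {a : ℝ} (ha : 0 < a) (q : ℝ) :
    ∫ t in (-Real.pi)..Real.pi, (a ^ 2 + t ^ 2) ^ (-q / 2) =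
      2 * a ^ (1 - q) * ∫ u in (0 : ℝ)..(Real.pi / a), (1 + u ^ 2) ^ (-q / 2) := by
  have hc := continuous_add_sq_rpow ha (-q / 2)
  have h1 : ∫ t in (-Real.pi)..0, (a ^ 2 + t ^ 2) ^ (-q / 2) =
      ∫ t in (0 : ℝ)..Real.pi, (a ^ 2 + t ^ 2) ^ (-q / 2) := by
    have := intervalIntegral.integral_comp_neg (a := 0) (b := Real.pi)
      (fun t : ℝ => (a ^ 2 + t ^ 2) ^ (-q / 2))
    simpa using this.symm
  rw [← intervalIntegral.integral_add_adjacent_intervals (hc.intervalIntegrable _ _)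
    (hc.intervalIntegrable 0 _), h1]
  have h2 := intervalIntegral.integral_comp_div (a := 0) (b := Real.pi)
    (fun t : ℝ => (1 + t ^ 2) ^ (-q / 2)) ha.ne'
  simp only [zero_div, smul_eq_mul] at h2
  have h3 : ∀ t : ℝ, (a ^ 2 + t ^ 2) ^ (-q / 2) = a ^ (-q) * (1 + (t / a) ^ 2) ^ (-q / 2) := by
    intro t
    have : a ^ 2 + t ^ 2 = a ^ 2 * (1 + (t / a) ^ 2) := by
      field_simp
    rw [this, Real.mul_rpow (by positivity) (by positivity), ← Real.rpow_natCast a,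
      ← Real.rpow_mul ha.le]
    congr 2
    push_cast
    ring
  simp_rw [h3]
  rw [intervalIntegral.integral_const_mul, h2, sub_eq_add_neg, Real.rpow_add ha, Real.rpow_one]
  ring

/-- The leading term `a^{-1/p} (2 ∫_0^∞ (1 + u²)^{-q/2} du)^{1/q}`, where `1/p = 1 - 1/q`. -/
noncomputable def leadingTerm (a q : ℝ) : ℝ :=
  a ^ (-(1 - 1 / q)) * (2 * tailIntegral q) ^ (1 / q)

lemma norm_add_sq_eq {a q : ℝ} (ha : 0 < a) (hq : 1 < q) :
    (∫ t in (-Real.pi)..Real.pi, (a ^ 2 + t ^ 2) ^ (-q / 2)) ^ (1 / q) =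
      a ^ (-(1 - 1 / q)) *
        (2 * ∫ u in (0 : ℝ)..(Real.pi / a), (1 + u ^ 2) ^ (-q / 2)) ^ (1 / q) := by
  have h0 := integral_one_add_sq_nonneg q (div_pos Real.pi_pos ha).le
  rw [integral_add_sq_rpow ha, mul_comm (2 : ℝ), mul_assoc,
    Real.mul_rpow (by positivity) (by positivity), ← Real.rpow_mul ha.le]
  congr 2
  field_simp
  ring

lemma norm_add_sq_le_leadingTerm {a q : ℝ} (ha : 0 < a) (hq : 1 < q) :
    (∫ t in (-Real.pi)..Real.pi, (a ^ 2 + t ^ 2) ^ (-q / 2)) ^ (1 / q) ≤ leadingTerm a q := by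
  have h0 := integral_one_add_sq_nonneg q (div_pos Real.pi_pos ha).le
  have h1 := integral_Ioi_one_add_sq_nonneg q (Real.pi / a)
  rw [norm_add_sq_eq ha hq, leadingTerm, tailIntegral_eq_add hq (div_pos Real.pi_pos ha).le]
  gcongr
  linarith

/-- Absorbs the factor q produced by `le_tailIntegral` into the power of the truncation point π/a.
-/
lemma le_pi_rpow {q : ℝ} (hq : 1 < q) : q ≤ Real.pi ^ (q - 1) := by
  have h : Real.exp 1 ≤ Real.pi := by linarith [Real.exp_one_lt_d9, Real.pi_gt_three]
  have h1 : (Real.exp 1) ^ (q - 1) ≤ Real.pi ^ (q - 1) :=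
    Real.rpow_le_rpow (Real.exp_pos _).le h (by linarith)
  rw [← Real.exp_mul, one_mul] at h1
  linarith [Real.add_one_le_exp (q - 1)]

/-- With I the full integral, J the truncated one and τ = I - J, the inequality x ≤ x^{1/q} on [0,1]
at x = J/I gives I^{1/q} - J^{1/q} ≤ τ I^{1/q-1} ≤ 2qτ. The tail bound τ ≤ (π/a)^{1-q}/(q-1) then
produces the (αr)^{(p'-1)/p}/(p'-1) term of the theorem. -/
lemma leadingTerm_sub_le {a q : ℝ} (ha : 0 < a) (hq : 1 < q) :
    leadingTerm a q - (∫ t in (-Real.pi)..Real.pi, (a ^ 2 + t ^ 2) ^ (-q / 2)) ^ (1 / q) ≤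
      4 * (a ^ ((q - 1) * (1 - 1 / q)) / (q - 1)) := by
  have hc := (div_pos Real.pi_pos ha)
  have h0 := integral_one_add_sq_nonneg q hc.le
  have h1 := integral_Ioi_one_add_sq_nonneg q (Real.pi / a)
  have h2 := integral_Ioi_one_add_sq_rpow_le hq hc
  have hI := le_tailIntegral hq
  have hsum := tailIntegral_eq_add hq hc.le
  rw [norm_add_sq_eq ha hq, leadingTerm]
  set J := ∫ u in (0 : ℝ)..(Real.pi / a), (1 + u ^ 2) ^ (-q / 2)
  set τ := ∫ u in Ioi (Real.pi / a), (1 + u ^ 2) ^ (-q / 2)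
  set I := tailIntegral q
  have hq0 : 0 < q := by linarith
  have hI0 : 0 < I := lt_of_lt_of_le (by positivity) hI
  have hinv : 1 / q < 1 := by
    rw [div_lt_one hq0]
    exact hq
  have hinv0 : 0 < 1 / q := by positivity
  have hstep : I ^ (1 / q) - J ^ (1 / q) ≤ τ * (2 * q) := by
    have e1 : J / I ≤ (J / I) ^ (1 / q) := by
      refine Real.self_le_rpow_of_le_one (by positivity) ?_ hinv.le
      rw [div_le_one hI0]
      linarith
    rw [Real.div_rpow h0 hI0.le] at e1
    have e2 : 0 < I ^ (1 / q) := Real.rpow_pos_of_pos hI0 _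
    have e3 : J / I * I ^ (1 / q) ≤ J ^ (1 / q) := by
      rwa [← le_div_iff₀ e2]
    have e4 : I ^ (1 / q) / I ≤ 2 * q := by
      have : I ^ (1 / q) / I = (I⁻¹) ^ (1 - 1 / q) := by
        rw [Real.inv_rpow hI0.le, ← Real.rpow_neg hI0.le, neg_sub, Real.rpow_sub hI0, Real.rpow_one]
      rw [this]
      have e5 : I⁻¹ ≤ 2 * q := by
        rw [inv_le_comm₀ hI0 (by positivity)]
        simpa using hI
      calc (I⁻¹) ^ (1 - 1 / q) ≤ (2 * q) ^ (1 - 1 / q) :=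
            Real.rpow_le_rpow (by positivity) e5 (by linarith)
        _ ≤ (2 * q) ^ (1 : ℝ) :=
            Real.rpow_le_rpow_of_exponent_le (by linarith) (by linarith)
        _ = 2 * q := Real.rpow_one _
    have e6 : I ^ (1 / q) - J / I * I ^ (1 / q) = τ * (I ^ (1 / q) / I) := by
      have : τ = I - J := by linarith
      rw [this]
      field_simp
    calc I ^ (1 / q) - J ^ (1 / q) ≤ I ^ (1 / q) - J / I * I ^ (1 / q) := by linarith
      _ = τ * (I ^ (1 / q) / I) := e6
      _ ≤ τ * (2 * q) := by gcongr
  have h2q : (2 : ℝ) ^ (1 / q) ≤ 2 := by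
    calc (2 : ℝ) ^ (1 / q) ≤ 2 ^ (1 : ℝ) :=
          Real.rpow_le_rpow_of_exponent_le (by norm_num) hinv.le
      _ = 2 := Real.rpow_one _
  have hτ : τ * q ≤ a ^ (q - 1) / (q - 1) := by
    have hq1 : 0 < q - 1 := by linarith
    have e7 : (Real.pi / a) ^ (1 - q) * q ≤ a ^ (q - 1) := by
      have : (Real.pi / a) ^ (1 - q) = a ^ (q - 1) / Real.pi ^ (q - 1) := by
        rw [← neg_sub q 1, Real.rpow_neg hc.le, Real.div_rpow Real.pi_pos.le ha.le, inv_div]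
      rw [this, div_mul_eq_mul_div, div_le_iff₀ (by positivity)]
      gcongr
      exact le_pi_rpow hq
    calc τ * q ≤ (Real.pi / a) ^ (1 - q) / (q - 1) * q := by gcongr
      _ = ((Real.pi / a) ^ (1 - q) * q) / (q - 1) := by ring
      _ ≤ _ := by gcongr
  have hτ0 : 0 ≤ τ * q := by positivity
  have hpow : a ^ (-(1 - 1 / q)) * a ^ (q - 1) = a ^ ((q - 1) * (1 - 1 / q)) := by
    rw [← Real.rpow_add ha]
    congr 1
    field_simp
    ring
  rw [Real.mul_rpow (by norm_num) hI0.le, Real.mul_rpow (by norm_num) h0, ← mul_sub, ← mul_sub,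
    ← hpow]
  have hA : 0 < a ^ (-(1 - 1 / q)) := Real.rpow_pos_of_pos ha _
  have hB : (2 : ℝ) ^ (1 / q) * (I ^ (1 / q) - J ^ (1 / q)) ≤ 2 * (τ * (2 * q)) := by
    calc (2 : ℝ) ^ (1 / q) * (I ^ (1 / q) - J ^ (1 / q)) ≤ (2 : ℝ) ^ (1 / q) * (τ * (2 * q)) := by
          gcongr
      _ ≤ _ := mul_le_mul_of_nonneg_right h2q (by positivity)
  calc a ^ (-(1 - 1 / q)) * ((2 : ℝ) ^ (1 / q) * (I ^ (1 / q) - J ^ (1 / q)))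
      ≤ a ^ (-(1 - 1 / q)) * (4 * (a ^ (q - 1) / (q - 1))) := by
        refine mul_le_mul_of_nonneg_left ?_ hA.le
        linarith
    _ = _ := by ring

/-- Since q/(q-1) is the conjugate exponent p, this is the origin of the factor p^{1/p'} in the
remainder. -/
lemma leadingTerm_le {a q : ℝ} (ha : 0 < a) (hq : 1 < q) :
    leadingTerm a q ≤ 2 * (a ^ (-(1 - 1 / q)) * (q / (q - 1)) ^ (1 / q)) := by
  have hI := tailIntegral_le hq
  have hI0 : 0 ≤ tailIntegral q := le_trans (by positivity) (le_tailIntegral hq)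
  have h2q : (2 : ℝ) ^ (1 / q) ≤ 2 := by
    calc (2 : ℝ) ^ (1 / q) ≤ 2 ^ (1 : ℝ) :=
          Real.rpow_le_rpow_of_exponent_le (by norm_num) (by
            rw [div_le_one (by linarith)]
            exact hq.le)
      _ = 2 := Real.rpow_one _
  rw [leadingTerm, Real.mul_rpow (by norm_num) hI0, mul_left_comm]
  gcongr

/-! ### Comparison of the tail kernel with a geometric series. -/

/-- Multiplication by 1 - ρz leaves the coefficients c_{j+1} - ρc_j, all nonnegative, so the modulus
on the unit circle is largest at z = 1, which is the right-hand side. -/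
lemma norm_one_sub_mul_tsum_sub_one_le {c : ℕ → ℝ} {ρ : ℝ} {z : ℂ} (hc : Summable c)
    (hc0 : c 0 = 1) (hpos : ∀ j, 0 ≤ c j) (hρ : ∀ j, ρ * c j ≤ c (j + 1)) (hz : ‖z‖ = 1) :
    ‖(1 - ρ * z) * (∑' j, (c j : ℂ) * z ^ j) - 1‖ ≤ (1 - ρ) * (∑' j, c j) - 1 := by
  have hs : Summable fun j => (c j : ℂ) * z ^ j := by
    refine Summable.of_norm (hc.congr fun j => ?_)
    rw [norm_mul, norm_pow, hz, one_pow, mul_one, Complex.norm_real, Real.norm_of_nonneg (hpos j)]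
  have h1 : (∑' j, (c j : ℂ) * z ^ j) = 1 + ∑' j, (c (j + 1) : ℂ) * z ^ (j + 1) := by
    rw [hs.tsum_eq_zero_add]
    simp [hc0]
  have hs1 : Summable fun j => (c (j + 1) : ℂ) * z ^ (j + 1) := (summable_nat_add_iff 1).2 hs
  have hc1 : Summable fun j => c (j + 1) := (summable_nat_add_iff 1).2 hc
  have h2 : (1 - ρ * z) * (∑' j, (c j : ℂ) * z ^ j) - 1 =
      ∑' j, ((c (j + 1) - ρ * c j : ℝ) : ℂ) * z ^ (j + 1) := by
    have e : (fun j => ((c (j + 1) - ρ * c j : ℝ) : ℂ) * z ^ (j + 1)) =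
        fun j => (c (j + 1) : ℂ) * z ^ (j + 1) - ρ * z * ((c j : ℂ) * z ^ j) := by
      funext j
      push_cast
      ring
    rw [e, hs1.tsum_sub (hs.mul_left _), tsum_mul_left, sub_mul, one_mul]
    nth_rewrite 1 [h1]
    ring
  have hs2 : Summable fun j => c (j + 1) - ρ * c j := hc1.sub (hc.mul_left ρ)
  have hn : ∀ j, ‖((c (j + 1) - ρ * c j : ℝ) : ℂ) * z ^ (j + 1)‖ = c (j + 1) - ρ * c j := by
    intro j
    rw [norm_mul, norm_pow, hz, one_pow, mul_one, Complex.norm_real,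
      Real.norm_of_nonneg (by linarith [hρ j])]
  rw [h2]
  refine (norm_tsum_le_tsum_norm (by simpa only [hn] using hs2)).trans ?_
  simp_rw [hn]
  rw [hc1.tsum_sub (hc.mul_left ρ), tsum_mul_left, hc.tsum_eq_zero_add, hc0]
  linarith

/-- The ratios `e^{-α (n + j)^r} / e^{-α n^r}`. -/
noncomputable def expRatio (α r : ℝ) (n j : ℕ) : ℝ :=
  Real.exp (-α * (((n : ℝ) + j) ^ r - (n : ℝ) ^ r))

lemma expRatio_zero (α r : ℝ) (n : ℕ) : expRatio α r n 0 = 1 := by simp [expRatio]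

lemma expRatio_pos (α r : ℝ) (n j : ℕ) : 0 < expRatio α r n j := Real.exp_pos _

lemma exp_mul_expRatio (α r : ℝ) (n j : ℕ) :
    Real.exp (-α * (n : ℝ) ^ r) * expRatio α r n j = Real.exp (-α * ((n : ℝ) + j) ^ r) := by
  rw [expRatio, ← Real.exp_add]
  congr 1
  ring

/-- Concavity of x^r (Bernoulli's inequality): an increment over a unit step from n+j is at most
r(n+j)^{r-1} ≤ r n^{r-1}. This supplies the hypothesis of `norm_one_sub_mul_tsum_sub_one_le` with ρ
= e^{-a}. -/
lemma exp_neg_mul_expRatio_le {α r : ℝ} (hα : 0 < α) (hr0 : 0 < r) (hr1 : r < 1) {n : ℕ}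
    (hn : 1 ≤ n) (j : ℕ) :
    Real.exp (-(α * r * (n : ℝ) ^ (r - 1))) * expRatio α r n j ≤ expRatio α r n (j + 1) := by
  have hn' : (0 : ℝ) < n := by exact_mod_cast hn
  have hy : (0 : ℝ) < (n : ℝ) + j := by positivity
  have h1 : ((n : ℝ) + j + 1) ^ r ≤ ((n : ℝ) + j) ^ r + r * ((n : ℝ) + j) ^ (r - 1) := by
    have e : (n : ℝ) + j + 1 = ((n : ℝ) + j) * (1 + 1 / ((n : ℝ) + j)) := by
      field_simp
    rw [e, Real.mul_rpow hy.le (by positivity), Real.rpow_sub_one hy.ne']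
    have := rpow_one_add_le_one_add_mul_self (s := 1 / ((n : ℝ) + j))
      (by linarith [(by positivity : 0 ≤ 1 / ((n : ℝ) + j))]) hr0.le hr1.le
    calc ((n : ℝ) + j) ^ r * (1 + 1 / ((n : ℝ) + j)) ^ r
        ≤ ((n : ℝ) + j) ^ r * (1 + r * (1 / ((n : ℝ) + j))) := by gcongr
      _ = _ := by ring
  have h2 : ((n : ℝ) + j) ^ (r - 1) ≤ (n : ℝ) ^ (r - 1) :=
    Real.rpow_le_rpow_of_nonpos hn' (by linarith [(Nat.cast_nonneg j : (0 : ℝ) ≤ j)])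
      (by linarith)
  rw [expRatio, expRatio, ← Real.exp_add, Real.exp_le_exp]
  push_cast
  rw [← add_assoc]
  have h3 : r * ((n : ℝ) + j) ^ (r - 1) ≤ r * (n : ℝ) ^ (r - 1) := by gcongr
  have h4 : α * ((n : ℝ) + j + 1) ^ r ≤ α * (((n : ℝ) + j) ^ r + r * (n : ℝ) ^ (r - 1)) := by
    gcongr
    linarith
  linarith

/-- The function -t^{1-r}e^{-αt^r}/(αr) is almost a primitive of e^{-αt^r}: its derivative carries
the extra factor 1 - (1-r)t^{-r}/(αr). The mean value theorem on [y, y+1] thus bounds one term of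
the series by a difference that telescopes. -/
lemma mul_exp_le_sub {α r : ℝ} (hα : 0 < α) (hr0 : 0 < r) (hr1 : r < 1) {x y : ℝ}
    (hx : 0 < x) (hxy : x ≤ y) (h : 1 / (α * r * x ^ r) ≤ 1) :
    α * r * (1 - 1 / (α * r * x ^ r)) * Real.exp (-α * (y + 1) ^ r) ≤
      y ^ (1 - r) * Real.exp (-α * y ^ r) - (y + 1) ^ (1 - r) * Real.exp (-α * (y + 1) ^ r) := by
  have hy : 0 < y := hx.trans_le hxy
  have hd : ∀ t : ℝ, 0 < t → HasDerivAt (fun t : ℝ => t ^ (1 - r) * Real.exp (-α * t ^ r))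
      (-(Real.exp (-α * t ^ r) * (α * r - (1 - r) * t ^ (-r)))) t := by
    intro t ht
    have h1 := Real.hasDerivAt_rpow_const (x := t) (p := 1 - r) (Or.inl ht.ne')
    have h2 := ((Real.hasDerivAt_rpow_const (x := t) (p := r) (Or.inl ht.ne')).const_mul (-α)).exp
    refine (h1.mul h2).congr_deriv ?_
    have e1 : t ^ (1 - r) * t ^ (r - 1) = 1 := by
      rw [← Real.rpow_add ht]
      simp
    have e2 : (1 - r - 1 : ℝ) = -r := by ring
    rw [e2]
    linear_combination (-(α * r * Real.exp (-α * t ^ r))) * e1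
  obtain ⟨ξ, hξ, he⟩ := exists_hasDerivAt_eq_slope _ _ (by linarith : y < y + 1)
    (fun t ht => (hd t (hy.trans_le ht.1)).continuousAt.continuousWithinAt)
    (fun t ht => hd t (hy.trans ht.1))
  have hξ0 : 0 < ξ := hy.trans hξ.1
  rw [add_sub_cancel_left, div_one] at he
  have h1 : ξ ^ (-r) ≤ x ^ (-r) :=
    Real.rpow_le_rpow_of_nonpos hx (hxy.trans hξ.1.le) (by linarith)
  have h2 : α * r * (1 - 1 / (α * r * x ^ r)) = α * r - x ^ (-r) := by
    rw [Real.rpow_neg hx.le]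
    have := (Real.rpow_pos_of_pos hx r).ne'
    field_simp
  have h3 : α * r * (1 - 1 / (α * r * x ^ r)) ≤ α * r - (1 - r) * ξ ^ (-r) := by
    rw [h2]
    have := Real.rpow_nonneg hξ0.le (-r)
    nlinarith
  have h4 : Real.exp (-α * (y + 1) ^ r) ≤ Real.exp (-α * ξ ^ r) := by
    rw [Real.exp_le_exp]
    have : ξ ^ r ≤ (y + 1) ^ r := Real.rpow_le_rpow hξ0.le hξ.2.le hr0.le
    nlinarith
  have h5 : 0 ≤ α * r * (1 - 1 / (α * r * x ^ r)) := by
    have : 0 < α * r := by positivity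
    nlinarith
  calc _ ≤ (α * r - (1 - r) * ξ ^ (-r)) * Real.exp (-α * ξ ^ r) := by
        gcongr
        exact h5.trans h3
    _ = _ := by linarith

lemma sum_expRatio_le {α r : ℝ} (hα : 0 < α) (hr0 : 0 < r) (hr1 : r < 1) {n : ℕ}
    (hn : 1 ≤ n) (h : 1 / (α * r * (n : ℝ) ^ r) ≤ 1) (m : ℕ) :
    α * r * (n : ℝ) ^ (r - 1) * (1 - 1 / (α * r * (n : ℝ) ^ r)) *
      ∑ j ∈ Finset.range m, expRatio α r n (j + 1) ≤ 1 := by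
  have hn' : (0 : ℝ) < n := by exact_mod_cast hn
  set E := Real.exp (-α * (n : ℝ) ^ r) with hE
  have hE0 : 0 < E := Real.exp_pos _
  set Φ : ℕ → ℝ := fun j => ((n : ℝ) + j) ^ (1 - r) * Real.exp (-α * ((n : ℝ) + j) ^ r) with hΦ
  have h1 : ∀ j : ℕ, α * r * (1 - 1 / (α * r * (n : ℝ) ^ r)) * (E * expRatio α r n (j + 1)) ≤
      Φ j - Φ (j + 1) := by
    intro j
    have := mul_exp_le_sub hα hr0 hr1 hn' (y := (n : ℝ) + j)
      (by linarith [(Nat.cast_nonneg j : (0 : ℝ) ≤ j)]) h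
    rw [hE, exp_mul_expRatio]
    simp only [hΦ]
    push_cast
    rw [← add_assoc]
    exact this
  have h2 := Finset.sum_le_sum fun j (_ : j ∈ Finset.range m) => h1 j
  rw [Finset.sum_range_sub', ← Finset.mul_sum, ← Finset.mul_sum] at h2
  have h3 : Φ 0 = (n : ℝ) ^ (1 - r) * E := by simp [hΦ, hE]
  have h4 : 0 ≤ Φ m := by positivity
  have h5 : (n : ℝ) ^ (r - 1) * (n : ℝ) ^ (1 - r) = 1 := by
    rw [← Real.rpow_add hn']
    simp
  have h6 : α * r * (1 - 1 / (α * r * (n : ℝ) ^ r)) *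
      ∑ j ∈ Finset.range m, expRatio α r n (j + 1) ≤ (n : ℝ) ^ (1 - r) := by
    refine le_of_mul_le_mul_right ?_ hE0
    linarith
  calc _ = (n : ℝ) ^ (r - 1) * (α * r * (1 - 1 / (α * r * (n : ℝ) ^ r)) *
      ∑ j ∈ Finset.range m, expRatio α r n (j + 1)) := by ring
    _ ≤ (n : ℝ) ^ (r - 1) * (n : ℝ) ^ (1 - r) := by gcongr
    _ = 1 := h5

lemma summable_expRatio {α r : ℝ} (hα : 0 < α) (hr0 : 0 < r) (hr1 : r < 1) {n : ℕ}
    (hn : 1 ≤ n) (h : 1 / (α * r * (n : ℝ) ^ r) < 1) : Summable (expRatio α r n) := by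
  have hn' : (0 : ℝ) < n := by exact_mod_cast hn
  have hpos : 0 < α * r * (n : ℝ) ^ (r - 1) * (1 - 1 / (α * r * (n : ℝ) ^ r)) :=
    mul_pos (by positivity) (by linarith)
  refine (summable_nat_add_iff 1).1 ?_
  refine summable_of_sum_range_le (fun j => (expRatio_pos α r n (j + 1)).le)
    (c := 1 / (α * r * (n : ℝ) ^ (r - 1) * (1 - 1 / (α * r * (n : ℝ) ^ r)))) fun m => ?_
  rw [le_div_iff₀' hpos]
  exact sum_expRatio_le hα hr0 hr1 hn h.le m

/-- The summand a is the term j = 0; the rest sums to at most 1/(a(1-ε)), and 1/(1-ε) ≤ 1 + 2ε for ε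
≤ 1/2. -/
lemma tsum_expRatio_le {α r : ℝ} (hα : 0 < α) (hr0 : 0 < r) (hr1 : r < 1) {n : ℕ}
    (hn : 1 ≤ n) (h : 1 / (α * r * (n : ℝ) ^ r) ≤ 1 / 2) :
    α * r * (n : ℝ) ^ (r - 1) * ∑' j, expRatio α r n j ≤
      1 + α * r * (n : ℝ) ^ (r - 1) + 2 * (1 / (α * r * (n : ℝ) ^ r)) := by
  have hn' : (0 : ℝ) < n := by exact_mod_cast hn
  have hs := summable_expRatio hα hr0 hr1 hn (by linarith)
  have hε : 0 < 1 / (α * r * (n : ℝ) ^ r) := by positivity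
  have ha : 0 < α * r * (n : ℝ) ^ (r - 1) := by positivity
  have hb := sum_expRatio_le hα hr0 hr1 hn (by linarith)
  set ε := 1 / (α * r * (n : ℝ) ^ r)
  set a := α * r * (n : ℝ) ^ (r - 1)
  have hpos : 0 < a * (1 - ε) := mul_pos ha (by linarith)
  have h1 : ∑' j, expRatio α r n (j + 1) ≤ 1 / (a * (1 - ε)) := by
    refine Real.tsum_le_of_sum_range_le (fun j => (expRatio_pos α r n (j + 1)).le) fun m => ?_
    rw [le_div_iff₀' hpos]
    exact hb m
  rw [hs.tsum_eq_zero_add, expRatio_zero, mul_add, mul_one]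
  have h2 : a * ∑' j, expRatio α r n (j + 1) ≤ 1 + 2 * ε := by
    calc a * ∑' j, expRatio α r n (j + 1) ≤ a * (1 / (a * (1 - ε))) := by gcongr
      _ = 1 / (1 - ε) := by
        have : 1 - ε ≠ 0 := by linarith
        field_simp
      _ ≤ 1 + 2 * ε := by
        rw [div_le_iff₀ (by linarith)]
        nlinarith
  linarith

/-- The kernel `∑_{j ≥ 0} e^{-α ((n + j)^r - n^r)} e^{i j t}`. -/
noncomputable def tailKernel (α r : ℝ) (n : ℕ) (t : ℝ) : ℂ :=
  ∑' j : ℕ, (expRatio α r n j : ℂ) * Complex.exp (t * Complex.I) ^ j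

/-- The geometric kernel `1 / (1 - e^{-a + i t})`. -/
noncomputable def geomKernel (a t : ℝ) : ℂ :=
  (1 - (Real.exp (-a) : ℂ) * Complex.exp (t * Complex.I))⁻¹

lemma one_sub_exp_mul_exp_ne_zero {a : ℝ} (ha : 0 < a) (t : ℝ) :
    1 - (Real.exp (-a) : ℂ) * Complex.exp (t * Complex.I) ≠ 0 := by
  intro h
  have h1 : ‖(Real.exp (-a) : ℂ) * Complex.exp (t * Complex.I)‖ = 1 := by
    rw [← sub_eq_zero.1 h, norm_one]
  rw [norm_mul, Complex.norm_exp_ofReal_mul_I, mul_one, Complex.norm_real,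
    Real.norm_of_nonneg (Real.exp_pos _).le, Real.exp_eq_one_iff] at h1
  linarith

/-- K - G = G·((1 - e^{-a+it})K - 1), and the bracket is at most (1 - e^{-a})K(0) - 1 ≤ aK(0) - 1 ≤
a + 2ε. -/
lemma norm_tailKernel_sub_geomKernel_le {α r : ℝ} (hα : 0 < α) (hr0 : 0 < r) (hr1 : r < 1)
    {n : ℕ} (hn : 1 ≤ n) (h : 1 / (α * r * (n : ℝ) ^ r) ≤ 1 / 2) (t : ℝ) :
    ‖tailKernel α r n t - geomKernel (α * r * (n : ℝ) ^ (r - 1)) t‖ ≤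
      (α * r * (n : ℝ) ^ (r - 1) + 2 * (1 / (α * r * (n : ℝ) ^ r))) *
        ‖geomKernel (α * r * (n : ℝ) ^ (r - 1)) t‖ := by
  have hn' : (0 : ℝ) < n := by exact_mod_cast hn
  have hs := summable_expRatio hα hr0 hr1 hn (by linarith)
  have ha : 0 < α * r * (n : ℝ) ^ (r - 1) := by positivity
  have h1 := tsum_expRatio_le hα hr0 hr1 hn h
  have h2 := norm_one_sub_mul_tsum_sub_one_le hs (expRatio_zero α r n)
    (fun j => (expRatio_pos α r n j).le) (exp_neg_mul_expRatio_le hα hr0 hr1 hn)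
    (Complex.norm_exp_ofReal_mul_I t)
  set a := α * r * (n : ℝ) ^ (r - 1)
  have hS : 0 ≤ ∑' j, expRatio α r n j := tsum_nonneg fun j => (expRatio_pos α r n j).le
  have h3 : (1 - Real.exp (-a)) * ∑' j, expRatio α r n j ≤ a * ∑' j, expRatio α r n j := by
    gcongr
    linarith [Real.add_one_le_exp (-a)]
  have h4 := one_sub_exp_mul_exp_ne_zero ha t
  have h5 : tailKernel α r n t - geomKernel a t = geomKernel a t *
      ((1 - (Real.exp (-a) : ℂ) * Complex.exp (t * Complex.I)) * tailKernel α r n t - 1) := by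
    rw [geomKernel]
    field_simp
  rw [h5, norm_mul, mul_comm]
  gcongr
  rw [tailKernel]
  linarith

/-! ### The geometric kernel: variation, and comparison with the Cauchy kernel. -/

/-- G(t) - G(s) = G(t)G(s)e^{-a}(e^{it} - e^{is}), where |G(s)|e^{-a} ≤ e^{-a}/(1-e^{-a}) ≤ 1/a. The
bound is relative to G(t), so it passes directly to L_q norms. -/
lemma norm_geomKernel_sub_le {a : ℝ} (ha : 0 < a) (s t : ℝ) :
    ‖geomKernel a t - geomKernel a s‖ ≤ |t - s| / a * ‖geomKernel a t‖ := by
  have h1 := one_sub_exp_mul_exp_ne_zero ha t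
  have h2 := one_sub_exp_mul_exp_ne_zero ha s
  have h3 : geomKernel a t - geomKernel a s = geomKernel a t * (geomKernel a s *
      ((Real.exp (-a) : ℂ) * (Complex.exp (t * Complex.I) - Complex.exp (s * Complex.I)))) := by
    rw [geomKernel, geomKernel, inv_sub_inv h1 h2, div_eq_mul_inv, mul_inv]
    ring
  have h4 : ‖Complex.exp (t * Complex.I) - Complex.exp (s * Complex.I)‖ ≤ |t - s| := by
    have e : Complex.exp (t * Complex.I) - Complex.exp (s * Complex.I) =
        Complex.exp (s * Complex.I) * (Complex.exp (Complex.I * ((t - s : ℝ) : ℂ)) - 1) := by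
      rw [mul_sub, ← Complex.exp_add]
      push_cast
      ring_nf
    rw [e, norm_mul, Complex.norm_exp_ofReal_mul_I, one_mul]
    exact Real.norm_exp_I_mul_ofReal_sub_one_le
  have h5 : ‖geomKernel a s‖ * Real.exp (-a) ≤ 1 / a := by
    rw [geomKernel, norm_inv, ← div_eq_inv_mul]
    have h6 : 1 - Real.exp (-a) ≤
        ‖1 - (Real.exp (-a) : ℂ) * Complex.exp (s * Complex.I)‖ := by
      have := norm_sub_norm_le (1 : ℂ) ((Real.exp (-a) : ℂ) * Complex.exp (s * Complex.I))
      rwa [norm_one, norm_mul, Complex.norm_exp_ofReal_mul_I, mul_one, Complex.norm_real,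
        Real.norm_of_nonneg (Real.exp_pos _).le] at this
    have h7 : 0 < 1 - Real.exp (-a) := by
      have := Real.exp_lt_exp.2 (neg_lt_zero.2 ha)
      rw [Real.exp_zero] at this
      linarith
    have h8 : Real.exp (-a) * (1 + a) ≤ 1 := by
      have : Real.exp (-a) * (a + 1) ≤ Real.exp (-a) * Real.exp a := by
        gcongr
        exact Real.add_one_le_exp a
      rw [← Real.exp_add] at this
      simp at this
      linarith
    rw [div_le_div_iff₀ (h7.trans_le h6) ha]
    linarith
  rw [h3, norm_mul, norm_mul, norm_mul, Complex.norm_real,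
    Real.norm_of_nonneg (Real.exp_pos _).le, ← mul_assoc (‖geomKernel a s‖), mul_comm]
  gcongr
  calc _ ≤ 1 / a * |t - s| := by gcongr
    _ = _ := by ring

lemma norm_exp_neg_sub_one_add_le {z : ℂ} (hz : 0 ≤ z.re) :
    ‖Complex.exp (-z) - 1 + z‖ ≤ 3 * ‖z‖ ^ 2 := by
  rcases le_or_gt ‖z‖ 1 with h | h
  · have := Complex.norm_exp_sub_one_sub_id_le (x := -z) (by simpa using h)
    rw [norm_neg, sub_neg_eq_add] at this
    nlinarith [sq_nonneg ‖z‖]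
  · have h1 : ‖Complex.exp (-z)‖ ≤ 1 := by
      rw [Complex.norm_exp]
      simpa using hz
    have h2 : ‖Complex.exp (-z) - 1 + z‖ ≤ ‖Complex.exp (-z)‖ + 1 + ‖z‖ := by
      refine (norm_add_le _ _).trans ?_
      gcongr
      simpa using norm_sub_le (Complex.exp (-z)) 1
    nlinarith

/-- With ρ = e^{-a}, |1 - ρe^{it}|² = (1-ρ)² + 2ρ(1 - cos t), where 1-ρ ≥ a/2, ρ ≥ 1/2 and 1 - cos t
≥ 2t²/π² ≥ t²/5; nine times this exceeds a² + t². -/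
lemma norm_le_norm_one_sub_exp {a t : ℝ} (ha : 0 < a) (ha2 : a ≤ 1 / 2) (ht : |t| ≤ Real.pi) :
    ‖(a - t * Complex.I : ℂ)‖ ≤
      3 * ‖1 - (Real.exp (-a) : ℂ) * Complex.exp (t * Complex.I)‖ := by
  have hρ : 1 / 2 ≤ Real.exp (-a) := by linarith [Real.add_one_le_exp (-a)]
  have hρa : a / 2 ≤ 1 - Real.exp (-a) := by
    have h8 : Real.exp (-a) * (a + 1) ≤ Real.exp (-a) * Real.exp a := by
      gcongr
      exact Real.add_one_le_exp a
    rw [← Real.exp_add] at h8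
    simp at h8
    nlinarith
  have hcos := Real.cos_le_one_sub_mul_cos_sq ht
  have hpi : 1 / 5 ≤ 2 / Real.pi ^ 2 := by
    rw [div_le_div_iff₀ (by norm_num) (by positivity)]
    nlinarith [Real.pi_pos, Real.pi_lt_d2]
  have h1 : ‖(a - t * Complex.I : ℂ)‖ ^ 2 = a ^ 2 + t ^ 2 := by
    rw [← Complex.normSq_eq_norm_sq, Complex.normSq_apply]
    simp
    ring
  have h2 : ‖1 - (Real.exp (-a) : ℂ) * Complex.exp (t * Complex.I)‖ ^ 2 =
      (1 - Real.exp (-a)) ^ 2 + 2 * Real.exp (-a) * (1 - Real.cos t) := by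
    rw [← Complex.normSq_eq_norm_sq, Complex.normSq_apply]
    simp only [Complex.sub_re, Complex.one_re, Complex.re_ofReal_mul, Complex.exp_ofReal_mul_I_re,
      Complex.sub_im, Complex.one_im, Complex.im_ofReal_mul, Complex.exp_ofReal_mul_I_im]
    linear_combination Real.exp (-a) ^ 2 * Real.sin_sq_add_cos_sq t
  refine abs_le_of_sq_le_sq' ?_ (by positivity) |>.2
  rw [mul_pow, h1, h2]
  have h3 : 1 / 5 * t ^ 2 ≤ 1 - Real.cos t := by
    have : 1 / 5 * t ^ 2 ≤ 2 / Real.pi ^ 2 * t ^ 2 := by gcongr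
    linarith
  have h4 : (a / 2) ^ 2 ≤ (1 - Real.exp (-a)) ^ 2 := by gcongr
  have h5 : 1 * (1 / 5 * t ^ 2) ≤ 2 * Real.exp (-a) * (1 - Real.cos t) := by
    gcongr
    linarith
  nlinarith [sq_nonneg t, sq_nonneg a]

/-- The Cauchy kernel `1 / (a - i t)`. -/
noncomputable def cauchyKernel (a t : ℝ) : ℂ := (a - t * Complex.I : ℂ)⁻¹

lemma sub_mul_I_ne_zero {a : ℝ} (ha : 0 < a) (t : ℝ) : (a - t * Complex.I : ℂ) ≠ 0 := by
  intro h
  have := congrArg Complex.re h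
  simp at this
  exact ha.ne' this

lemma norm_cauchyKernel_rpow {a : ℝ} (ha : 0 < a) (q t : ℝ) :
    ‖cauchyKernel a t‖ ^ q = (a ^ 2 + t ^ 2) ^ (-q / 2) := by
  have h1 : ‖(a - t * Complex.I : ℂ)‖ = (a ^ 2 + t ^ 2) ^ (1 / 2 : ℝ) := by
    rw [← Real.sqrt_eq_rpow, Complex.norm_def, Complex.normSq_apply]
    congr 1
    simp
    ring
  have h0 : 0 < a ^ 2 + t ^ 2 := by positivity
  rw [cauchyKernel, norm_inv, h1, ← Real.rpow_neg h0.le, ← Real.rpow_mul h0.le]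
  congr 1
  ring

/-- For z = a - it the difference is (e^{-z} - 1 + z)/((1-e^{-z})z): the numerator is at most 3|z|²
and the denominator at least |z|²/3. -/
lemma norm_geomKernel_sub_cauchyKernel_le {a t : ℝ} (ha : 0 < a) (ha2 : a ≤ 1 / 2)
    (ht : |t| ≤ Real.pi) : ‖geomKernel a t - cauchyKernel a t‖ ≤ 9 := by
  have h1 := one_sub_exp_mul_exp_ne_zero ha t
  have h2 := sub_mul_I_ne_zero ha t
  have h3 := norm_le_norm_one_sub_exp ha ha2 ht
  have he : Complex.exp (-(a - t * Complex.I)) =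
      (Real.exp (-a) : ℂ) * Complex.exp (t * Complex.I) := by
    rw [Complex.ofReal_exp, ← Complex.exp_add]
    push_cast
    ring_nf
  have h4 := norm_exp_neg_sub_one_add_le (z := a - t * Complex.I) (by simpa using ha.le)
  rw [he] at h4
  rw [geomKernel, cauchyKernel, inv_sub_inv h1 h2, norm_div, norm_mul]
  have h5 : 0 < ‖(a - t * Complex.I : ℂ)‖ := norm_pos_iff.2 h2
  have h6 := norm_pos_iff.2 h1
  rw [div_le_iff₀ (by positivity)]
  have h7 : (a - t * Complex.I : ℂ) - (1 - (Real.exp (-a) : ℂ) * Complex.exp (t * Complex.I)) =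
      (Real.exp (-a) : ℂ) * Complex.exp (t * Complex.I) - 1 + (a - t * Complex.I) := by ring
  rw [h7]
  nlinarith

lemma geomKernel_periodic (a : ℝ) : Function.Periodic (geomKernel a) (2 * Real.pi) := by
  intro t
  have : Complex.exp (((t + 2 * Real.pi : ℝ) : ℂ) * Complex.I) = Complex.exp (t * Complex.I) := by
    rw [← Complex.exp_periodic (t * Complex.I)]
    push_cast
    ring_nf
  rw [geomKernel, geomKernel, this]

lemma continuous_geomKernel {a : ℝ} (ha : 0 < a) : Continuous (geomKernel a) := by
  unfold geomKernel
  exact Continuous.inv₀ (by fun_prop) (one_sub_exp_mul_exp_ne_zero ha)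

/-! ### Blocks of length 2π/n and exact integrals of modulated step functions. -/

/-- The index of the block of length `2π / n` containing `t`. -/
noncomputable def blockIndex (n : ℕ) (t : ℝ) : ℤ := ⌊n * t / (2 * Real.pi)⌋

lemma measurable_blockIndex (n : ℕ) : Measurable (blockIndex n) := by
  unfold blockIndex
  fun_prop

lemma blockIndex_add (n : ℕ) (t : ℝ) :
    blockIndex n (t + 2 * Real.pi) = blockIndex n t + n := by
  have h : (2 * Real.pi) ≠ 0 := by positivity
  rw [blockIndex, blockIndex, mul_add, add_div, mul_div_cancel_right₀ _ h]
  exact Int.floor_add_natCast _ _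

lemma blockIndex_eq {n : ℕ} (hn : 1 ≤ n) {m : ℕ} {t : ℝ}
    (h1 : 2 * Real.pi / n * m ≤ t) (h2 : t < 2 * Real.pi / n * (m + 1)) :
    blockIndex n t = m := by
  have hn' : (0 : ℝ) < n := by exact_mod_cast hn
  have hp := Real.pi_pos
  rw [div_mul_eq_mul_div, div_le_iff₀ hn'] at h1
  rw [div_mul_eq_mul_div, lt_div_iff₀ hn'] at h2
  rw [blockIndex, Int.floor_eq_iff, le_div_iff₀ (by positivity), div_lt_iff₀ (by positivity)]
  push_cast
  constructor <;> linarith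

lemma abs_sub_block_le {n : ℕ} (hn : 1 ≤ n) (t : ℝ) :
    |t - 2 * Real.pi / n * blockIndex n t| ≤ 2 * Real.pi / n := by
  have hn' : (0 : ℝ) < n := by exact_mod_cast hn
  have hp := Real.pi_pos
  have h1 : (blockIndex n t : ℝ) ≤ n * t / (2 * Real.pi) := Int.floor_le _
  have h2 : n * t / (2 * Real.pi) < blockIndex n t + 1 := Int.lt_floor_add_one _
  rw [le_div_iff₀ (by positivity)] at h1
  rw [div_lt_iff₀ (by positivity)] at h2
  rw [abs_le]
  constructor
  · rw [← sub_nonneg]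
    have : t - 2 * Real.pi / n * blockIndex n t - -(2 * Real.pi / n) =
        (n * t - blockIndex n t * (2 * Real.pi) + 2 * Real.pi) / n := by
      field_simp
      ring
    rw [this]
    exact div_nonneg (by linarith) hn'.le
  · rw [← sub_nonneg]
    have : 2 * Real.pi / n - (t - 2 * Real.pi / n * blockIndex n t) =
        ((blockIndex n t + 1) * (2 * Real.pi) - n * t) / n := by
      field_simp
      ring
    rw [this]
    exact div_nonneg (by linarith) hn'.le

/-- While t runs through one block, nt runs through one full period, so each block contributes 1/n
of a period integral. -/
lemma integral_block {n : ℕ} (hn : 1 ≤ n) {Ψ : ℤ → ℝ → ℝ}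
    (hper : ∀ m, Function.Periodic (Ψ m) (2 * Real.pi)) (hadd : ∀ m, Ψ (m + n) = Ψ m)
    (hint : ∀ m a b, IntervalIntegrable (Ψ m) volume a b) :
    ∫ t in (-Real.pi)..Real.pi, Ψ (blockIndex n t) (n * t) =
      1 / n * ∑ m ∈ Finset.range n, ∫ x in (0 : ℝ)..(2 * Real.pi), Ψ m x := by
  have hn' : (0 : ℝ) < n := by exact_mod_cast hn
  have hp : Function.Periodic (fun t => Ψ (blockIndex n t) (n * t)) (2 * Real.pi) := by
    intro t
    simp only
    rw [blockIndex_add, hadd, mul_add]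
    exact (hper _).nat_mul n (n * t)
  -- For odd n the point -π is not a block endpoint; periodicity moves the integral to [0, 2π],
  -- which is a union of blocks.
  have h1 := hp.intervalIntegral_add_eq (-Real.pi) 0
  rw [zero_add, show -Real.pi + 2 * Real.pi = Real.pi by ring] at h1
  rw [h1]
  have heq : ∀ m : ℕ, EqOn (fun t => Ψ (blockIndex n t) (n * t)) (fun t => Ψ m (n * t))
      (Ioo (2 * Real.pi / n * m) (2 * Real.pi / n * ((m + 1 : ℕ) : ℝ))) := by
    intro m t ht
    have h2 := ht.2
    push_cast at h2
    simp only
    rw [blockIndex_eq hn ht.1.le h2]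
  have hle : ∀ m : ℕ, 2 * Real.pi / n * m ≤ 2 * Real.pi / n * ((m + 1 : ℕ) : ℝ) := by
    intro m
    push_cast
    have := Real.pi_pos
    gcongr
    linarith
  have hae : ∀ m : ℕ, (fun t => Ψ (blockIndex n t) (n * t)) =ᵐ[volume.restrict
      (uIoc (2 * Real.pi / n * m) (2 * Real.pi / n * ((m + 1 : ℕ) : ℝ)))]
      (fun t => Ψ m (n * t)) := by
    intro m
    rw [uIoc_of_le (hle m), ← Measure.restrict_congr_set Ioo_ae_eq_Ioc]
    exact (ae_restrict_iff' measurableSet_Ioo).2 (Filter.Eventually.of_forall (heq m))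
  have hcomp : ∀ (m : ℤ) (a b : ℝ), IntervalIntegrable (fun t => Ψ m (n * t)) volume a b := by
    intro m a b
    have := (hint m (n * a) (n * b)).comp_mul_left (c := (n : ℝ))
    simpa [hn'.ne'] using this
  have h2 := intervalIntegral.sum_integral_adjacent_intervals (μ := volume)
    (f := fun t => Ψ (blockIndex n t) (n * t)) (a := fun m : ℕ => 2 * Real.pi / n * m) (n := n)
    (fun m _ => (hcomp m _ _).congr_ae (hae m).symm)
  have hend : 2 * Real.pi / n * (n : ℝ) = 2 * Real.pi := by field_simp
  simp only [Nat.cast_zero, mul_zero, hend] at h2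
  rw [← h2, Finset.mul_sum]
  refine Finset.sum_congr rfl fun m _ => ?_
  rw [intervalIntegral.integral_congr_ae_restrict (hae m),
    intervalIntegral.integral_comp_mul_left _ hn'.ne', smul_eq_mul, ← one_div]
  congr 1
  have e1 : (n : ℝ) * (2 * Real.pi / n * m) = m * (2 * Real.pi) := by field_simp
  have e2 : (n : ℝ) * (2 * Real.pi / n * ((m + 1 : ℕ) : ℝ)) = m * (2 * Real.pi) + 2 * Real.pi := by
    push_cast
    field_simp
  rw [e1, e2, (hper m).intervalIntegral_add_eq _ 0, zero_add]

lemma exp_mul_I_mul_re (x : ℝ) (w : ℂ) :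
    (Complex.exp (x * Complex.I) * w).re = ‖w‖ * Real.cos (x + w.arg) := by
  have h : Complex.exp (x * Complex.I) * w =
      (‖w‖ : ℂ) * Complex.exp (((x + w.arg : ℝ) : ℂ) * Complex.I) := by
    nth_rewrite 1 [← Complex.norm_mul_exp_arg_mul_I w]
    rw [mul_left_comm, ← Complex.exp_add]
    push_cast
    ring_nf
  rw [h, Complex.re_ofReal_mul, Complex.exp_ofReal_mul_I_re]

lemma abs_exp_mul_I_mul_re_le (x : ℝ) (w : ℂ) :
    |(Complex.exp (x * Complex.I) * w).re| ≤ ‖w‖ := by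
  refine (Complex.abs_re_le_norm _).trans ?_
  rw [norm_mul, Complex.norm_exp_ofReal_mul_I, one_mul]

/-- The phases arg w and θ only translate the cosine and vanish over a full period, which is why β
does not enter the main term. -/
lemma integral_abs_rotation_rpow (q θ : ℝ) (w : ℂ) :
    ∫ x in (0 : ℝ)..(2 * Real.pi), |(Complex.exp ((x - θ : ℝ) * Complex.I) * w).re| ^ q =
      ‖w‖ ^ q * ∫ x in (0 : ℝ)..(2 * Real.pi), |Real.cos x| ^ q := by
  have h1 : ∀ x : ℝ, |(Complex.exp ((x - θ : ℝ) * Complex.I) * w).re| ^ q =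
      ‖w‖ ^ q * |Real.cos (x + (w.arg - θ))| ^ q := by
    intro x
    rw [exp_mul_I_mul_re, abs_mul, abs_norm, Real.mul_rpow (norm_nonneg _) (abs_nonneg _)]
    congr 4
    ring
  simp_rw [h1]
  rw [intervalIntegral.integral_const_mul]
  congr 1
  rw [intervalIntegral.integral_comp_add_right (fun x => |Real.cos x| ^ q)]
  have hp : Function.Periodic (fun x => |Real.cos x| ^ q) (2 * Real.pi) := by
    intro x
    simp only [Real.cos_add_two_pi]
  rw [zero_add, add_comm (2 * Real.pi), hp.intervalIntegral_add_eq _ 0, zero_add]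

/-- The geometric kernel sampled at the left end points of the blocks of length `2π / n`. -/
noncomputable def blockKernel (a : ℝ) (n : ℕ) (t : ℝ) : ℂ :=
  geomKernel a (2 * Real.pi / n * blockIndex n t)

lemma geomKernel_block_add (a : ℝ) {n : ℕ} (hn : 1 ≤ n) (m : ℤ) :
    geomKernel a (2 * Real.pi / n * ((m + n : ℤ) : ℝ)) = geomKernel a (2 * Real.pi / n * m) := by
  have hn' : (0 : ℝ) < n := by exact_mod_cast hn
  rw [← geomKernel_periodic a (2 * Real.pi / n * m)]
  congr 1
  push_cast
  field_simp

/-- The modulated sampled kernel `Re (e^{i (n t - θ)} G₁(t))`. -/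
noncomputable def modBlock (a θ : ℝ) (n : ℕ) (t : ℝ) : ℝ :=
  (Complex.exp ((n * t - θ : ℝ) * Complex.I) * blockKernel a n t).re

/-- The modulated tail kernel `∑_{j ≥ 0} e^{-α ((n + j)^r - n^r)} cos ((n + j) t - θ)`. -/
noncomputable def modTail (α r θ : ℝ) (n : ℕ) (t : ℝ) : ℝ :=
  (Complex.exp ((n * t - θ : ℝ) * Complex.I) * tailKernel α r n t).re

lemma exp_sub_mul_I_add_two_pi (x θ : ℝ) :
    Complex.exp ((x + 2 * Real.pi - θ : ℝ) * Complex.I) =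
      Complex.exp ((x - θ : ℝ) * Complex.I) := by
  rw [← Complex.exp_periodic (((x - θ : ℝ) : ℂ) * Complex.I)]
  push_cast
  ring_nf

lemma integral_abs_modBlock_rpow {q : ℝ} (hq : 0 < q) (a θ : ℝ) {n : ℕ} (hn : 1 ≤ n) :
    ∫ t in (-Real.pi)..Real.pi, |modBlock a θ n t| ^ q =
      (1 / (2 * Real.pi) * ∫ x in (0 : ℝ)..(2 * Real.pi), |Real.cos x| ^ q) *
        ∫ t in (-Real.pi)..Real.pi, ‖blockKernel a n t‖ ^ q := by
  have hpi := Real.pi_pos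
  have h1 := integral_block hn (Ψ := fun m x => |(Complex.exp ((x - θ : ℝ) * Complex.I) *
    geomKernel a (2 * Real.pi / n * m)).re| ^ q)
    (by
      intro m x
      simp only
      rw [exp_sub_mul_I_add_two_pi])
    (by
      intro m
      funext x
      rw [geomKernel_block_add a hn])
    (by
      intro m c d
      refine Continuous.intervalIntegrable ?_ _ _
      exact Continuous.rpow_const (by fun_prop) fun x => Or.inr hq.le)
  -- Applied to functions constant in x: each block then contributes 2π times the amplitude, whence
  -- the factor 1/(2π).
  have h2 := integral_block hn (Ψ := fun m _ => ‖geomKernel a (2 * Real.pi / n * m)‖ ^ q)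
    (by
      intro m x
      rfl)
    (by
      intro m
      funext x
      rw [geomKernel_block_add a hn])
    (by
      intro m c d
      exact intervalIntegrable_const)
  simp only [integral_abs_rotation_rpow] at h1
  simp only [intervalIntegral.integral_const, sub_zero, smul_eq_mul] at h2
  have h3 : ∫ t in (-Real.pi)..Real.pi, |modBlock a θ n t| ^ q = _ := h1
  have h4 : ∫ t in (-Real.pi)..Real.pi, ‖blockKernel a n t‖ ^ q = _ := h2
  rw [h3, h4, ← Finset.sum_mul, ← Finset.mul_sum]
  field_simp

/-- The map y|y|^{q-2} = sign(y)|y|^{q-1} builds the equality case of Hölder's inequality. For q < 2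
the second factor is discontinuous at 0, so measurability is used. -/
lemma measurable_mul_abs_rpow (q : ℝ) :
    Measurable fun y : ℝ => y * |y| ^ (q - 2) :=
  measurable_id.mul ((measurable_norm).pow_const _)

lemma abs_mul_abs_rpow {q : ℝ} (hq : 1 < q) (y : ℝ) :
    |y * |y| ^ (q - 2)| = |y| ^ (q - 1) := by
  rcases eq_or_ne y 0 with rfl | h
  · rw [zero_mul, abs_zero, Real.zero_rpow (by linarith)]
  · have h' : 0 < |y| := abs_pos.2 h
    rw [abs_mul, abs_of_nonneg (Real.rpow_nonneg h'.le _), ← Real.rpow_one_add' h'.le (by linarith)]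
    congr 1
    ring

lemma mul_mul_abs_rpow {q : ℝ} (hq : 1 < q) (y : ℝ) :
    y * (y * |y| ^ (q - 2)) = |y| ^ q := by
  rcases eq_or_ne y 0 with rfl | h
  · rw [zero_mul, abs_zero, Real.zero_rpow (by linarith)]
  · have h' : 0 < |y| := abs_pos.2 h
    have : y * (y * |y| ^ (q - 2)) = |y| ^ 2 * |y| ^ (q - 2) := by
      rw [sq_abs]
      ring
    rw [this, ← Real.rpow_natCast, ← Real.rpow_add h']
    congr 1
    push_cast
    ring

/-- The integrand changes sign under the half-period shift x ↦ x + π. -/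
lemma integral_rotation_mul_abs_rpow {q : ℝ} (θ : ℝ) (w : ℂ) :
    ∫ x in (0 : ℝ)..(2 * Real.pi), (Complex.exp ((x - θ : ℝ) * Complex.I) * w).re *
      |(Complex.exp ((x - θ : ℝ) * Complex.I) * w).re| ^ (q - 2) = 0 := by
  set F : ℝ → ℝ := fun x => (Complex.exp ((x - θ : ℝ) * Complex.I) * w).re *
      |(Complex.exp ((x - θ : ℝ) * Complex.I) * w).re| ^ (q - 2) with hF
  have hp : Function.Periodic F (2 * Real.pi) := by
    intro x
    simp only [hF]
    rw [exp_sub_mul_I_add_two_pi]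
  have hodd : ∀ x, F (x + Real.pi) = -F x := by
    intro x
    have : Complex.exp ((x + Real.pi - θ : ℝ) * Complex.I) =
        -Complex.exp ((x - θ : ℝ) * Complex.I) := by
      have e : ((x + Real.pi - θ : ℝ) : ℂ) * Complex.I =
          ((x - θ : ℝ) : ℂ) * Complex.I + Real.pi * Complex.I := by
        push_cast
        ring
      rw [e, Complex.exp_add, Complex.exp_pi_mul_I]
      ring
    simp only [hF]
    rw [this, neg_mul, Complex.neg_re, abs_neg, neg_mul]
  have h1 : ∫ x in (0 : ℝ)..(2 * Real.pi), F (x + Real.pi) =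
      ∫ x in (0 : ℝ)..(2 * Real.pi), F x := by
    rw [intervalIntegral.integral_comp_add_right, zero_add, add_comm (2 * Real.pi),
      hp.intervalIntegral_add_eq _ 0, zero_add]
  simp_rw [hodd] at h1
  rw [intervalIntegral.integral_neg] at h1
  linarith

/-- This is the purpose of the sampling: the dual function of the sampled kernel is exactly
orthogonal to constants, hence admissible in the class. -/
lemma integral_modBlock_mul_abs_rpow {q : ℝ} (hq : 1 < q) (a θ : ℝ) {n : ℕ} (hn : 1 ≤ n) :
    ∫ t in (-Real.pi)..Real.pi, modBlock a θ n t * |modBlock a θ n t| ^ (q - 2) = 0 := by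
  have h1 := integral_block hn (Ψ := fun m x => (Complex.exp ((x - θ : ℝ) * Complex.I) *
    geomKernel a (2 * Real.pi / n * m)).re * |(Complex.exp ((x - θ : ℝ) * Complex.I) *
    geomKernel a (2 * Real.pi / n * m)).re| ^ (q - 2))
    (by
      intro m x
      simp only
      rw [exp_sub_mul_I_add_two_pi])
    (by
      intro m
      funext x
      rw [geomKernel_block_add a hn])
    (by
      intro m c d
      have hc : Continuous fun x : ℝ => (Complex.exp ((x - θ : ℝ) * Complex.I) *
        geomKernel a (2 * Real.pi / n * m)).re := by fun_prop
      refine (intervalIntegrable_const (c := ‖geomKernel a (2 * Real.pi / n * m)‖ ^ (q - 1))).mono_fun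
        ((measurable_mul_abs_rpow q).comp hc.measurable).aestronglyMeasurable ?_
      refine Filter.Eventually.of_forall fun x => ?_
      simp only
      rw [Real.norm_eq_abs, abs_mul_abs_rpow hq, Real.norm_of_nonneg (by positivity)]
      exact Real.rpow_le_rpow (abs_nonneg _) (abs_exp_mul_I_mul_re_le _ _) (by linarith))
  simp only [integral_rotation_mul_abs_rpow, Finset.sum_const_zero, mul_zero] at h1
  exact h1

/-! ### Norms over a period and the norm estimates for the kernels. -/

/-- Lebesgue measure on the period `(-π, π]`. -/
noncomputable abbrev periodMeasure : Measure ℝ := volume.restrict (Ioc (-Real.pi) Real.pi)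

lemma integral_periodMeasure (f : ℝ → ℝ) :
    ∫ t, f t ∂periodMeasure = ∫ t in (-Real.pi)..Real.pi, f t := by
  rw [intervalIntegral.integral_of_le (by linarith [Real.pi_pos])]

lemma periodMeasure_univ : periodMeasure univ = ENNReal.ofReal (2 * Real.pi) := by
  rw [Measure.restrict_apply_univ, Real.volume_Ioc]
  congr 1
  ring

/-- The norm of `L_q` over the period `(-π, π]`. -/
noncomputable abbrev perNorm {E : Type*} [NormedAddCommGroup E] (q : ℝ) (f : ℝ → E) : ℝ :=
  lpNorm f (ENNReal.ofReal q) periodMeasure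

/-- Membership in `L_q` over the period `(-π, π]`. -/
abbrev PerMem {E : Type*} [NormedAddCommGroup E] (q : ℝ) (f : ℝ → E) : Prop :=
  MemLp f (ENNReal.ofReal q) periodMeasure

section

variable {E F : Type*} [NormedAddCommGroup E] [NormedAddCommGroup F]

lemma one_le_ofReal {q : ℝ} (hq : 1 < q) : 1 ≤ ENNReal.ofReal q := by
  rw [← ENNReal.ofReal_one]
  exact ENNReal.ofReal_le_ofReal hq.le

lemma perNorm_eq {q : ℝ} (hq : 0 < q) {f : ℝ → E} (hf : AEStronglyMeasurable f periodMeasure) :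
    perNorm q f = (∫ t in (-Real.pi)..Real.pi, ‖f t‖ ^ q) ^ (1 / q) := by
  rw [perNorm, lpNorm_eq_integral_norm_rpow_toReal (by simpa using hq) ENNReal.ofReal_ne_top hf,
    ENNReal.toReal_ofReal hq.le, integral_periodMeasure, one_div]

lemma perNorm_le_mul {q : ℝ} {f : ℝ → E} {g : ℝ → F} {c : ℝ} (hc : 0 ≤ c)
    (hg : PerMem q g) (h : ∀ t, ‖f t‖ ≤ c * ‖g t‖) :
    perNorm q f ≤ c * perNorm q g := by
  have h1 := lpNorm_mono_real (p := ENNReal.ofReal q) (μ := periodMeasure) (f := f)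
    (g := c • fun t => ‖g t‖) (hg.norm.const_smul c) h
  rwa [lpNorm_const_smul, lpNorm_norm hg.1, coe_nnnorm,
    Real.norm_of_nonneg hc] at h1

lemma perNorm_le_of_bound {q : ℝ} (hq : 1 < q) {f : ℝ → E} {C : ℝ} (hC : 0 ≤ C)
    (hf : AEStronglyMeasurable f periodMeasure) (h : ∀ t, |t| ≤ Real.pi → ‖f t‖ ≤ C) :
    perNorm q f ≤ 2 * Real.pi * C := by
  have hae : ∀ᵐ t ∂periodMeasure, ‖f t‖ ≤ C := by
    refine (ae_restrict_iff' measurableSet_Ioc).2 (Filter.Eventually.of_forall fun t ht => h t ?_)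
    exact abs_le.2 ⟨ht.1.le, ht.2⟩
  have h1 := eLpNorm_le_of_ae_bound (p := ENNReal.ofReal q) hae
  rw [periodMeasure_univ, ENNReal.toReal_ofReal (by linarith)] at h1
  have hpi : 1 ≤ 2 * Real.pi := by linarith [Real.pi_gt_three]
  have h2 : ENNReal.ofReal (2 * Real.pi) ^ q⁻¹ * ENNReal.ofReal C ≤
      ENNReal.ofReal (2 * Real.pi * C) := by
    rw [ENNReal.ofReal_mul (p := 2 * Real.pi) (by linarith)]
    gcongr
    rw [ENNReal.ofReal_rpow_of_pos (by linarith)]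
    refine ENNReal.ofReal_le_ofReal ?_
    calc (2 * Real.pi) ^ q⁻¹ ≤ (2 * Real.pi) ^ (1 : ℝ) :=
          Real.rpow_le_rpow_of_exponent_le hpi (inv_le_one_of_one_le₀ hq.le)
      _ = _ := Real.rpow_one _
  rw [perNorm, ← toReal_eLpNorm hf]
  exact ENNReal.toReal_le_of_le_ofReal (by positivity) (h1.trans h2)

lemma abs_perNorm_sub_le {q : ℝ} (hq : 1 < q) {f g : ℝ → E} (hf : PerMem q f) (hg : PerMem q g) :
    |perNorm q f - perNorm q g| ≤ perNorm q (f - g) := by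
  have h1 := lpNorm_le_lpNorm_add_lpNorm_sub' (f := f) hg (one_le_ofReal hq)
  have h2 := lpNorm_le_lpNorm_add_lpNorm_sub (f := g) hf (one_le_ofReal hq)
  rw [abs_le]
  constructor <;> linarith

lemma perMem_of_bound {q : ℝ} {f : ℝ → E} (hf : AEStronglyMeasurable f periodMeasure) (C : ℝ)
    (h : ∀ t, ‖f t‖ ≤ C) : PerMem q f :=
  MemLp.of_bound hf C (Filter.Eventually.of_forall h)

end

lemma norm_geomKernel_le {a : ℝ} (ha : 0 < a) (t : ℝ) :
    ‖geomKernel a t‖ ≤ (1 - Real.exp (-a))⁻¹ := by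
  have h7 : 0 < 1 - Real.exp (-a) := by
    have := Real.exp_lt_exp.2 (neg_lt_zero.2 ha)
    rw [Real.exp_zero] at this
    linarith
  rw [geomKernel, norm_inv]
  refine inv_anti₀ h7 ?_
  have := norm_sub_norm_le (1 : ℂ) ((Real.exp (-a) : ℂ) * Complex.exp (t * Complex.I))
  rwa [norm_one, norm_mul, Complex.norm_exp_ofReal_mul_I, mul_one, Complex.norm_real,
    Real.norm_of_nonneg (Real.exp_pos _).le] at this

lemma perMem_geomKernel {a : ℝ} (ha : 0 < a) (q : ℝ) : PerMem q (geomKernel a) :=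
  perMem_of_bound (continuous_geomKernel ha).aestronglyMeasurable _ (norm_geomKernel_le ha)

lemma measurable_blockKernel {a : ℝ} (ha : 0 < a) (n : ℕ) : Measurable (blockKernel a n) := by
  have := measurable_blockIndex n
  exact (continuous_geomKernel ha).measurable.comp (by fun_prop)

lemma perMem_blockKernel {a : ℝ} (ha : 0 < a) (n : ℕ) (q : ℝ) : PerMem q (blockKernel a n) :=
  perMem_of_bound (measurable_blockKernel ha n).aestronglyMeasurable _
    fun _ => norm_geomKernel_le ha _

lemma measurable_modBlock {a : ℝ} (ha : 0 < a) (θ : ℝ) (n : ℕ) : Measurable (modBlock a θ n) := by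
  have h1 := measurable_blockKernel ha n
  exact Complex.measurable_re.comp (Measurable.mul (by fun_prop) h1)

lemma abs_modBlock_le {a : ℝ} (ha : 0 < a) (θ : ℝ) (n : ℕ) (t : ℝ) :
    |modBlock a θ n t| ≤ (1 - Real.exp (-a))⁻¹ :=
  (abs_exp_mul_I_mul_re_le _ _).trans (norm_geomKernel_le ha _)

lemma perMem_modBlock {a : ℝ} (ha : 0 < a) (θ : ℝ) (n : ℕ) (q : ℝ) : PerMem q (modBlock a θ n) :=
  perMem_of_bound (measurable_modBlock ha θ n).aestronglyMeasurable _ (abs_modBlock_le ha θ n)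

lemma norm_expRatio_mul_exp_pow (α r : ℝ) (n j : ℕ) (t : ℝ) :
    ‖(expRatio α r n j : ℂ) * Complex.exp (t * Complex.I) ^ j‖ = expRatio α r n j := by
  rw [norm_mul, norm_pow, Complex.norm_exp_ofReal_mul_I, one_pow, mul_one, Complex.norm_real,
    Real.norm_of_nonneg (expRatio_pos α r n j).le]

lemma continuous_tailKernel {α r : ℝ} {n : ℕ} (hs : Summable (expRatio α r n)) :
    Continuous (tailKernel α r n) :=
  continuous_tsum (fun j => by fun_prop) hs fun j t => (norm_expRatio_mul_exp_pow α r n j t).le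

lemma continuous_modTail {α r : ℝ} {n : ℕ} (hs : Summable (expRatio α r n)) (θ : ℝ) :
    Continuous (modTail α r θ n) := by
  have := continuous_tailKernel hs
  unfold modTail
  fun_prop

lemma norm_tailKernel_le {α r : ℝ} {n : ℕ} (hs : Summable (expRatio α r n)) (t : ℝ) :
    ‖tailKernel α r n t‖ ≤ ∑' j, expRatio α r n j := by
  unfold tailKernel
  have := norm_tsum_le_tsum_norm (f := fun j => (expRatio α r n j : ℂ) *
    Complex.exp (t * Complex.I) ^ j) (by simpa only [norm_expRatio_mul_exp_pow] using hs)
  simpa only [norm_expRatio_mul_exp_pow] using this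

lemma perMem_modTail {α r : ℝ} {n : ℕ} (hs : Summable (expRatio α r n)) (θ q : ℝ) :
    PerMem q (modTail α r θ n) :=
  perMem_of_bound (continuous_modTail hs θ).aestronglyMeasurable _
    fun t => (abs_exp_mul_I_mul_re_le _ _).trans (norm_tailKernel_le hs t)

/-- A block has length 2π/n, so `norm_geomKernel_sub_le` gives a relative error 2π/(na) = 2πε. -/
lemma norm_geomKernel_sub_blockKernel_le {a : ℝ} (ha : 0 < a) {n : ℕ} (hn : 1 ≤ n) (t : ℝ) :
    ‖geomKernel a t - blockKernel a n t‖ ≤ 2 * Real.pi * (1 / (n * a)) * ‖geomKernel a t‖ := by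
  have hn' : (0 : ℝ) < n := by exact_mod_cast hn
  refine (norm_geomKernel_sub_le ha _ t).trans ?_
  gcongr
  calc _ ≤ 2 * Real.pi / n / a := by
        gcongr
        exact abs_sub_block_le hn t
    _ = _ := by
        field_simp

/-- The normalised `L_q` norm `((2π)⁻¹ ∫_0^{2π} |cos x|^q dx)^{1/q}` of the cosine. -/
noncomputable def cosMean (q : ℝ) : ℝ :=
  (1 / (2 * Real.pi) * ∫ x in (0 : ℝ)..(2 * Real.pi), |Real.cos x| ^ q) ^ (1 / q)

lemma integral_abs_cos_rpow_nonneg (q : ℝ) :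
    0 ≤ ∫ x in (0 : ℝ)..(2 * Real.pi), |Real.cos x| ^ q :=
  intervalIntegral.integral_nonneg (by positivity) fun _ _ => by positivity

lemma cosMean_nonneg (q : ℝ) : 0 ≤ cosMean q := by
  have := integral_abs_cos_rpow_nonneg q
  unfold cosMean
  positivity

lemma cosMean_le_one {q : ℝ} (hq : 0 < q) : cosMean q ≤ 1 := by
  have h0 := integral_abs_cos_rpow_nonneg q
  refine Real.rpow_le_one (by positivity) ?_ (by positivity)
  have hpi := Real.pi_pos
  have h1 : ∫ x in (0 : ℝ)..(2 * Real.pi), |Real.cos x| ^ q ≤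
      ∫ x in (0 : ℝ)..(2 * Real.pi), (1 : ℝ) := by
    refine intervalIntegral.integral_mono_on (by positivity) ?_ (by simp) fun x _ => ?_
    · exact (Continuous.rpow_const (by fun_prop) fun x => Or.inr hq.le).intervalIntegrable _ _
    · exact Real.rpow_le_one (abs_nonneg _) (Real.abs_cos_le_one x) hq.le
  rw [intervalIntegral.integral_const, sub_zero, smul_eq_mul, mul_one] at h1
  rw [one_div, ← div_eq_inv_mul, div_le_one (by positivity)]
  exact h1

lemma perNorm_modBlock {a q : ℝ} (ha : 0 < a) (hq : 0 < q) (θ : ℝ) {n : ℕ} (hn : 1 ≤ n) :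
    perNorm q (modBlock a θ n) = cosMean q * perNorm q (blockKernel a n) := by
  have h0 := integral_abs_cos_rpow_nonneg q
  rw [perNorm_eq hq (measurable_modBlock ha θ n).aestronglyMeasurable,
    perNorm_eq hq (measurable_blockKernel ha n).aestronglyMeasurable]
  simp_rw [Real.norm_eq_abs]
  rw [integral_abs_modBlock_rpow hq a θ hn, Real.mul_rpow (by positivity), cosMean]
  exact intervalIntegral.integral_nonneg (by linarith [Real.pi_pos]) fun _ _ => by positivity

lemma continuous_cauchyKernel {a : ℝ} (ha : 0 < a) : Continuous (cauchyKernel a) := by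
  unfold cauchyKernel
  exact Continuous.inv₀ (by fun_prop) (sub_mul_I_ne_zero ha)

lemma perMem_cauchyKernel {a : ℝ} (ha : 0 < a) (q : ℝ) : PerMem q (cauchyKernel a) := by
  refine perMem_of_bound (continuous_cauchyKernel ha).aestronglyMeasurable a⁻¹ fun t => ?_
  rw [cauchyKernel, norm_inv]
  refine inv_anti₀ ha ?_
  have := Complex.abs_re_le_norm (a - t * Complex.I : ℂ)
  simp at this
  exact (le_abs_self a).trans this

lemma abs_perNorm_cauchyKernel_sub_le {a q : ℝ} (ha : 0 < a) (hq : 1 < q) :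
    |perNorm q (cauchyKernel a) - leadingTerm a q| ≤
      4 * (a ^ ((q - 1) * (1 - 1 / q)) / (q - 1)) := by
  rw [perNorm_eq (by linarith) (continuous_cauchyKernel ha).aestronglyMeasurable]
  simp_rw [norm_cauchyKernel_rpow ha]
  have h1 := norm_add_sq_le_leadingTerm ha hq
  have h2 := leadingTerm_sub_le ha hq
  rw [abs_sub_comm, abs_of_nonneg (by linarith)]
  exact h2

/-- 18π = 2π·9 comes from the pointwise bound 9 against the Cauchy kernel; the other term is the
truncation error. -/
lemma abs_perNorm_geomKernel_sub_le {a q : ℝ} (ha : 0 < a) (ha2 : a ≤ 1 / 2) (hq : 1 < q) :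
    |perNorm q (geomKernel a) - leadingTerm a q| ≤
      18 * Real.pi + 4 * (a ^ ((q - 1) * (1 - 1 / q)) / (q - 1)) := by
  have h1 := abs_perNorm_sub_le hq (perMem_geomKernel ha q) (perMem_cauchyKernel ha q)
  have h2 := perNorm_le_of_bound hq (f := geomKernel a - cauchyKernel a) (C := 9) (by norm_num)
    ((continuous_geomKernel ha).sub (continuous_cauchyKernel ha)).aestronglyMeasurable
    fun t ht => norm_geomKernel_sub_cauchyKernel_le ha ha2 ht
  have h3 := abs_perNorm_cauchyKernel_sub_le ha hq
  have h4 := abs_sub_le (perNorm q (geomKernel a)) (perNorm q (cauchyKernel a)) (leadingTerm a q)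
  linarith

/-- Truncation only decreases the integral, so the upper bound is free of the truncation term; this
keeps that term out of the products with relative errors. -/
lemma perNorm_geomKernel_le {a q : ℝ} (ha : 0 < a) (ha2 : a ≤ 1 / 2) (hq : 1 < q) :
    perNorm q (geomKernel a) ≤ leadingTerm a q + 18 * Real.pi := by
  have h1 := abs_perNorm_sub_le hq (perMem_geomKernel ha q) (perMem_cauchyKernel ha q)
  have h2 := perNorm_le_of_bound hq (f := geomKernel a - cauchyKernel a) (C := 9) (by norm_num)
    ((continuous_geomKernel ha).sub (continuous_cauchyKernel ha)).aestronglyMeasurable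
    fun t ht => norm_geomKernel_sub_cauchyKernel_le ha ha2 ht
  have h3 := norm_add_sq_le_leadingTerm ha hq
  have h4 := perNorm_eq (q := q) (by linarith)
    (continuous_cauchyKernel ha).aestronglyMeasurable (f := cauchyKernel a)
  simp_rw [norm_cauchyKernel_rpow ha] at h4
  have h5 := (abs_le.1 h1).2
  linarith

lemma abs_perNorm_modBlock_sub_le {a q : ℝ} (ha : 0 < a) (ha2 : a ≤ 1 / 2) (hq : 1 < q) (θ : ℝ)
    {n : ℕ} (hn : 1 ≤ n) :
    |perNorm q (modBlock a θ n) - cosMean q * leadingTerm a q| ≤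
      2 * Real.pi * (1 / (n * a)) * perNorm q (geomKernel a) + 18 * Real.pi +
        4 * (a ^ ((q - 1) * (1 - 1 / q)) / (q - 1)) := by
  have h1 := abs_perNorm_sub_le hq (perMem_geomKernel ha q) (perMem_blockKernel ha n q)
  have h2 := perNorm_le_mul (f := geomKernel a - blockKernel a n) (by positivity)
    (perMem_geomKernel ha q) (norm_geomKernel_sub_blockKernel_le ha hn)
  have h3 := abs_perNorm_geomKernel_sub_le ha ha2 hq
  rw [perNorm_modBlock ha (by linarith) θ hn, ← mul_sub, abs_mul,
    abs_of_nonneg (cosMean_nonneg q)]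
  rw [abs_sub_comm] at h1
  have h4 := abs_sub_le (perNorm q (blockKernel a n)) (perNorm q (geomKernel a)) (leadingTerm a q)
  calc _ ≤ 1 * |perNorm q (blockKernel a n) - leadingTerm a q| := by
        gcongr
        exact cosMean_le_one (by linarith)
    _ ≤ _ := by linarith

/-- Modulation followed by the real part does not increase the modulus, so the relative errors a +
2ε and 2πε simply add, using na = αr n^r. -/
lemma perNorm_modTail_sub_modBlock_le {α r q : ℝ} (hα : 0 < α) (hr0 : 0 < r) (hr1 : r < 1)
    {n : ℕ} (hn : 1 ≤ n) (h : 1 / (α * r * (n : ℝ) ^ r) ≤ 1 / 2) (θ : ℝ) :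
    perNorm q (modTail α r θ n - modBlock (α * r * (n : ℝ) ^ (r - 1)) θ n) ≤
      (α * r * (n : ℝ) ^ (r - 1) + (2 + 2 * Real.pi) * (1 / (α * r * (n : ℝ) ^ r))) *
        perNorm q (geomKernel (α * r * (n : ℝ) ^ (r - 1))) := by
  have hn' : (0 : ℝ) < n := by exact_mod_cast hn
  have ha : 0 < α * r * (n : ℝ) ^ (r - 1) := by positivity
  refine perNorm_le_mul (by positivity) (perMem_geomKernel ha q) fun t => ?_
  have h1 := norm_tailKernel_sub_geomKernel_le hα hr0 hr1 hn h t
  have h2 := norm_geomKernel_sub_blockKernel_le ha hn t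
  have h3 : (n : ℝ) * (α * r * (n : ℝ) ^ (r - 1)) = α * r * (n : ℝ) ^ r := by
    rw [Real.rpow_sub_one hn'.ne']
    field_simp
  rw [h3] at h2
  set a := α * r * (n : ℝ) ^ (r - 1)
  have h4 : (modTail α r θ n - modBlock a θ n) t =
      (Complex.exp ((n * t - θ : ℝ) * Complex.I) * (tailKernel α r n t - blockKernel a n t)).re := by
    rw [Pi.sub_apply, modTail, modBlock, mul_sub, Complex.sub_re]
  rw [h4, Real.norm_eq_abs]
  refine (abs_exp_mul_I_mul_re_le _ _).trans ?_
  have h5 := norm_sub_le_norm_sub_add_norm_sub (tailKernel α r n t) (geomKernel a t)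
    (blockKernel a n t)
  linarith

/-! ### Fourier coefficients and the integral form of the remainder. -/

lemma hasSum_integral_mul {φ : ℝ → ℝ} (hφ : Integrable φ periodMeasure) {G : ℕ → ℝ → ℝ}
    {M : ℕ → ℝ} (hM : Summable M) (hc : ∀ k, Continuous (G k)) (hG : ∀ k t, |G k t| ≤ M k) :
    HasSum (fun k => ∫ t in (-Real.pi)..Real.pi, G k t * φ t)
      (∫ t in (-Real.pi)..Real.pi, (∑' k, G k t) * φ t) := by
  simp_rw [← integral_periodMeasure, ← tsum_mul_right]
  have hint : ∀ k, Integrable (fun t => G k t * φ t) periodMeasure := fun k =>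
    hφ.bdd_mul (c := M k) (hc k).aestronglyMeasurable (Filter.Eventually.of_forall (hG k))
  refine hasSum_integral_of_summable_integral_norm hint ?_
  refine Summable.of_nonneg_of_le (fun k => integral_nonneg fun t => norm_nonneg _) (fun k => ?_)
    (hM.mul_right (∫ t, ‖φ t‖ ∂periodMeasure))
  rw [← integral_const_mul]
  refine integral_mono (hint k).norm (hφ.norm.const_mul _) fun t => ?_
  simp only [norm_mul]
  exact mul_le_mul_of_nonneg_right (hG k t) (norm_nonneg _)

lemma integral_cos_int_mul (j : ℤ) :
    ∫ x in (-Real.pi)..Real.pi, Real.cos (j * x) = if j = 0 then 2 * Real.pi else 0 := by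
  split_ifs with h
  · subst h
    simp
    ring
  · have h' : (j : ℝ) ≠ 0 := by exact_mod_cast h
    rw [intervalIntegral.integral_comp_mul_left _ h', integral_cos, mul_neg, Real.sin_neg,
      Real.sin_int_mul_pi]
    simp

lemma integral_sin_int_mul (j : ℤ) : ∫ x in (-Real.pi)..Real.pi, Real.sin (j * x) = 0 := by
  have h := intervalIntegral.integral_comp_neg (a := -Real.pi) (b := Real.pi)
    (fun x => Real.sin (j * x))
  simp only [mul_neg, Real.sin_neg, neg_neg, intervalIntegral.integral_neg] at h
  linarith

lemma integral_cos_mul_cos (k m : ℕ) :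
    ∫ x in (-Real.pi)..Real.pi, Real.cos (k * x) * Real.cos (m * x) =
      if k = m then (if m = 0 then 2 * Real.pi else Real.pi) else 0 := by
  have h : ∀ x : ℝ, Real.cos (k * x) * Real.cos (m * x) =
      1 / 2 * (Real.cos (((k - m : ℤ) : ℝ) * x) + Real.cos (((k + m : ℤ) : ℝ) * x)) := by
    intro x
    push_cast
    rw [sub_mul, add_mul, Real.cos_sub, Real.cos_add]
    ring
  simp_rw [h]
  rw [intervalIntegral.integral_const_mul, intervalIntegral.integral_add
    (Continuous.intervalIntegrable (by fun_prop) _ _)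
    (Continuous.intervalIntegrable (by fun_prop) _ _), integral_cos_int_mul, integral_cos_int_mul]
  by_cases h1 : k = m
  · subst h1
    by_cases h2 : k = 0
    · simp [h2]
      ring
    · have : ((k : ℤ) + k) ≠ 0 := by omega
      simp [h2, this]
  · have h2 : ((k : ℤ) - m) ≠ 0 := by omega
    have h3 : ((k : ℤ) + m) ≠ 0 := by omega
    simp [h1, h2, h3]

lemma integral_sin_mul_sin (k m : ℕ) :
    ∫ x in (-Real.pi)..Real.pi, Real.sin (k * x) * Real.sin (m * x) =
      if k = m then (if m = 0 then 0 else Real.pi) else 0 := by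
  have h : ∀ x : ℝ, Real.sin (k * x) * Real.sin (m * x) =
      1 / 2 * (Real.cos (((k - m : ℤ) : ℝ) * x) - Real.cos (((k + m : ℤ) : ℝ) * x)) := by
    intro x
    push_cast
    rw [sub_mul, add_mul, Real.cos_sub, Real.cos_add]
    ring
  simp_rw [h]
  rw [intervalIntegral.integral_const_mul, intervalIntegral.integral_sub
    (Continuous.intervalIntegrable (by fun_prop) _ _)
    (Continuous.intervalIntegrable (by fun_prop) _ _), integral_cos_int_mul, integral_cos_int_mul]
  by_cases h1 : k = m
  · subst h1
    by_cases h2 : k = 0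
    · simp [h2]
    · have : ((k : ℤ) + k) ≠ 0 := by omega
      simp [h2, this]
  · have h2 : ((k : ℤ) - m) ≠ 0 := by omega
    have h3 : ((k : ℤ) + m) ≠ 0 := by omega
    simp [h1, h2, h3]

lemma integral_sin_mul_cos (k m : ℕ) :
    ∫ x in (-Real.pi)..Real.pi, Real.sin (k * x) * Real.cos (m * x) = 0 := by
  have h : ∀ x : ℝ, Real.sin (k * x) * Real.cos (m * x) =
      1 / 2 * (Real.sin (((k - m : ℤ) : ℝ) * x) + Real.sin (((k + m : ℤ) : ℝ) * x)) := by
    intro x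
    push_cast
    rw [sub_mul, add_mul, Real.sin_sub, Real.sin_add]
    ring
  simp_rw [h]
  rw [intervalIntegral.integral_const_mul, intervalIntegral.integral_add
    (Continuous.intervalIntegrable (by fun_prop) _ _)
    (Continuous.intervalIntegrable (by fun_prop) _ _), integral_sin_int_mul, integral_sin_int_mul]
  simp

/-- The `k`-th term `A_k cos k x + B_k sin k x` of a trigonometric series. -/
noncomputable def trigTerm (A B : ℕ → ℝ) (k : ℕ) (x : ℝ) : ℝ :=
  A k * Real.cos (k * x) + B k * Real.sin (k * x)

lemma abs_trigTerm_le (A B : ℕ → ℝ) (k : ℕ) (x : ℝ) : |trigTerm A B k x| ≤ |A k| + |B k| := by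
  refine (abs_add_le _ _).trans ?_
  rw [abs_mul, abs_mul]
  exact add_le_add (mul_le_of_le_one_right (abs_nonneg _) (Real.abs_cos_le_one _))
    (mul_le_of_le_one_right (abs_nonneg _) (Real.abs_sin_le_one _))

lemma continuous_trigTerm (A B : ℕ → ℝ) (k : ℕ) : Continuous (trigTerm A B k) := by
  unfold trigTerm
  fun_prop

/-- The doubling at m = 0 is undone by the half on the constant coefficient in `fourierSum`. -/
lemma cosCoeff_tsum_trigTerm {A B : ℕ → ℝ} (hAB : Summable fun k => |A k| + |B k|) (m : ℕ) :
    cosCoeff (fun x => ∑' k, trigTerm A B k x) m = if m = 0 then 2 * A 0 else A m := by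
  have hcos : Integrable (fun x => Real.cos (m * x)) periodMeasure :=
    (Continuous.integrableOn_Icc (by fun_prop)).mono_set Ioc_subset_Icc_self
  have h := hasSum_integral_mul hcos hAB (continuous_trigTerm A B) (abs_trigTerm_le A B)
  have hpi := Real.pi_ne_zero
  have h1 : ∀ k, ∫ x in (-Real.pi)..Real.pi, trigTerm A B k x * Real.cos (m * x) =
      A k * if k = m then (if m = 0 then 2 * Real.pi else Real.pi) else 0 := by
    intro k
    rw [← integral_cos_mul_cos, ← intervalIntegral.integral_const_mul]
    have e : ∀ x : ℝ, trigTerm A B k x * Real.cos (m * x) =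
        A k * (Real.cos (k * x) * Real.cos (m * x)) +
          B k * (Real.sin (k * x) * Real.cos (m * x)) := by
      intro x
      rw [trigTerm]
      ring
    simp_rw [e]
    rw [intervalIntegral.integral_add (Continuous.intervalIntegrable (by fun_prop) _ _)
      (Continuous.intervalIntegrable (by fun_prop) _ _),
      intervalIntegral.integral_const_mul (B k), integral_sin_mul_cos, mul_zero, add_zero]
  simp_rw [h1] at h
  rw [cosCoeff, ← h.tsum_eq, tsum_eq_single m (fun k hk => by simp [hk])]
  by_cases h0 : m = 0
  · subst h0
    simp
    field_simp
  · simp [h0]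
    field_simp

lemma sinCoeff_tsum_trigTerm {A B : ℕ → ℝ} (hAB : Summable fun k => |A k| + |B k|) {m : ℕ}
    (hm : m ≠ 0) : sinCoeff (fun x => ∑' k, trigTerm A B k x) m = B m := by
  have hsin : Integrable (fun x => Real.sin (m * x)) periodMeasure :=
    (Continuous.integrableOn_Icc (by fun_prop)).mono_set Ioc_subset_Icc_self
  have h := hasSum_integral_mul hsin hAB (continuous_trigTerm A B) (abs_trigTerm_le A B)
  have hpi := Real.pi_ne_zero
  have h1 : ∀ k, ∫ x in (-Real.pi)..Real.pi, trigTerm A B k x * Real.sin (m * x) =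
      B k * if k = m then (if m = 0 then 0 else Real.pi) else 0 := by
    intro k
    rw [← integral_sin_mul_sin, ← intervalIntegral.integral_const_mul]
    have e : ∀ x : ℝ, trigTerm A B k x * Real.sin (m * x) =
        A k * (Real.sin (m * x) * Real.cos (k * x)) +
          B k * (Real.sin (k * x) * Real.sin (m * x)) := by
      intro x
      rw [trigTerm]
      ring
    simp_rw [e]
    rw [intervalIntegral.integral_add (Continuous.intervalIntegrable (by fun_prop) _ _)
      (Continuous.intervalIntegrable (by fun_prop) _ _),
      intervalIntegral.integral_const_mul (A k), integral_sin_mul_cos, mul_zero, zero_add]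
  simp_rw [h1] at h
  rw [sinCoeff, ← h.tsum_eq, tsum_eq_single m (fun k hk => by simp [hk])]
  simp [hm]
  field_simp

lemma tsum_trigTerm_sub_fourierSum {A B : ℕ → ℝ} (hAB : Summable fun k => |A k| + |B k|)
    {n : ℕ} (hn : 1 ≤ n) (x : ℝ) :
    (∑' k, trigTerm A B k x) - fourierSum (n - 1) (fun x => ∑' k, trigTerm A B k x) x =
      ∑' j, trigTerm A B (n + j) x := by
  have hs : Summable fun k => trigTerm A B k x :=
    Summable.of_norm_bounded hAB fun k => abs_trigTerm_le A B k x
  have h1 : fourierSum (n - 1) (fun x => ∑' k, trigTerm A B k x) x =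
      ∑ k ∈ Finset.range n, trigTerm A B k x := by
    obtain ⟨m, rfl⟩ : ∃ m, n = m + 1 := ⟨n - 1, by omega⟩
    rw [fourierSum, Nat.add_sub_cancel, Finset.sum_range_succ', cosCoeff_tsum_trigTerm hAB,
      if_pos rfl, add_comm]
    congr 1
    · rw [Finset.range_eq_Ico, Finset.sum_Ico_add' (fun k => trigTerm A B k x) 0 m 1]
      refine Finset.sum_congr ?_ fun k hk => ?_
      · ext k
        simp
      · have hk0 : k ≠ 0 := by
          simp at hk
          omega
        rw [cosCoeff_tsum_trigTerm hAB, sinCoeff_tsum_trigTerm hAB hk0, if_neg hk0, trigTerm]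
    · simp [trigTerm]
  rw [h1, ← hs.sum_add_tsum_nat_add n, add_sub_cancel_left]
  exact tsum_congr fun j => by rw [add_comm]

lemma hasSum_modTail {α r : ℝ} {n : ℕ} (hs : Summable (expRatio α r n)) (θ t : ℝ) :
    HasSum (fun j : ℕ => expRatio α r n j * Real.cos (((n : ℝ) + j) * t - θ))
      (modTail α r θ n t) := by
  have h1 : Summable fun j => (expRatio α r n j : ℂ) * Complex.exp (t * Complex.I) ^ j :=
    Summable.of_norm (by simpa only [norm_expRatio_mul_exp_pow] using hs)
  have h2 := Complex.hasSum_re (h1.hasSum.mul_left (Complex.exp ((n * t - θ : ℝ) * Complex.I)))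
  refine h2.congr_fun ?_
  intro j
  rw [mul_left_comm, ← Complex.exp_nat_mul, ← Complex.exp_add, Complex.re_ofReal_mul,
    ← Complex.exp_ofReal_mul_I_re]
  congr 3
  push_cast
  ring

lemma summable_exp_neg_rpow {α r : ℝ} {n : ℕ} (hs : Summable (expRatio α r n)) :
    Summable fun k : ℕ => Real.exp (-α * (k : ℝ) ^ r) := by
  refine (summable_nat_add_iff n).1 ((hs.mul_left (Real.exp (-α * (n : ℝ) ^ r))).congr fun j => ?_)
  rw [exp_mul_expRatio]
  push_cast
  rw [add_comm]

/-- The addition formula turns f into an absolutely convergent trigonometric series, with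
coefficients bounded by multiples of e^{-αk^r}. Its Fourier sum is then its partial sum, and
e^{-αn^r} factors out of the tail. -/
lemma sub_fourierSum_eq {α r β : ℝ} {n : ℕ} (hn : 1 ≤ n) (hs : Summable (expRatio α r n))
    {φ f : ℝ → ℝ} (hφ : Integrable φ periodMeasure) {a₀ : ℝ}
    (hf : ∀ x : ℝ, f x = a₀ / 2 +
      1 / Real.pi * ∫ t in (-Real.pi)..Real.pi, poissonKernel α r β (x - t) * φ t) (x : ℝ) :
    f x - fourierSum (n - 1) f x = 1 / Real.pi * (Real.exp (-α * (n : ℝ) ^ r) *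
      ∫ t in (-Real.pi)..Real.pi, modTail α r (β * Real.pi / 2) n (x - t) * φ t) := by
  set θ := β * Real.pi / 2 with hθ
  set ψ : ℕ → ℝ := fun k => Real.exp (-α * (k : ℝ) ^ r) with hψ
  have hψs : Summable ψ := summable_exp_neg_rpow hs
  have hψ0 : ∀ k, 0 < ψ k := fun k => Real.exp_pos _
  have hK : ∀ k (x t : ℝ), |ψ k * Real.cos (k * (x - t) - θ)| ≤ ψ k := by
    intro k x t
    rw [abs_mul, abs_of_pos (hψ0 k)]
    exact mul_le_of_le_one_right (hψ0 k).le (Real.abs_cos_le_one _)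
  set A : ℕ → ℝ := fun k => if k = 0 then a₀ / 2 else
    1 / Real.pi * (ψ k * ∫ t in (-Real.pi)..Real.pi, Real.cos (k * t + θ) * φ t) with hA
  set B : ℕ → ℝ := fun k => if k = 0 then 0 else
    1 / Real.pi * (ψ k * ∫ t in (-Real.pi)..Real.pi, Real.sin (k * t + θ) * φ t) with hB
  have hcosint : ∀ (c d : ℝ), Integrable (fun t => Real.cos (c * t + d) * φ t) periodMeasure :=
    fun c d => hφ.bdd_mul (c := 1) (Continuous.aestronglyMeasurable (by fun_prop))
      (Filter.Eventually.of_forall fun t => Real.abs_cos_le_one _)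
  have hsinint : ∀ (c d : ℝ), Integrable (fun t => Real.sin (c * t + d) * φ t) periodMeasure :=
    fun c d => hφ.bdd_mul (c := 1) (Continuous.aestronglyMeasurable (by fun_prop))
      (Filter.Eventually.of_forall fun t => Real.abs_sin_le_one _)
  have hterm : ∀ k ≠ 0, ∀ x, trigTerm A B k x = 1 / Real.pi *
      ∫ t in (-Real.pi)..Real.pi, (ψ k * Real.cos (k * (x - t) - θ)) * φ t := by
    intro k hk x
    have e : ∀ t, (ψ k * Real.cos (k * (x - t) - θ)) * φ t =
        ψ k * Real.cos (k * x) * (Real.cos (k * t + θ) * φ t) +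
          ψ k * Real.sin (k * x) * (Real.sin (k * t + θ) * φ t) := by
      intro t
      rw [show (k : ℝ) * (x - t) - θ = k * x - (k * t + θ) by ring, Real.cos_sub]
      ring
    simp_rw [e, trigTerm, hA, hB, if_neg hk, ← integral_periodMeasure]
    rw [integral_add ((hcosint _ _).const_mul _) ((hsinint _ _).const_mul _), integral_const_mul,
      integral_const_mul]
    ring
  set C := ∫ t, ‖φ t‖ ∂periodMeasure with hC
  have hbound : ∀ (k : ℕ) (g : ℝ → ℝ), (∀ t, |g t| ≤ 1) →
      |1 / Real.pi * (ψ k * ∫ t in (-Real.pi)..Real.pi, g t * φ t)| ≤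
        1 / Real.pi * (ψ k * C) := by
    intro k g hg
    rw [abs_mul, abs_mul, abs_of_pos (hψ0 k), abs_of_pos (by positivity : 0 < 1 / Real.pi)]
    have hpi := Real.pi_pos
    have hk := hψ0 k
    gcongr
    rw [← integral_periodMeasure, ← Real.norm_eq_abs]
    refine norm_integral_le_of_norm_le hφ.norm (Filter.Eventually.of_forall fun t => ?_)
    rw [norm_mul]
    exact mul_le_of_le_one_left (norm_nonneg _) (hg t)
  have hAB : Summable fun k => |A k| + |B k| := by
    refine (summable_nat_add_iff 1).1 (Summable.of_nonneg_of_le (fun k => by positivity)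
      (fun k => ?_) (((summable_nat_add_iff 1).2 hψs).mul_right (2 * (1 / Real.pi * C))))
    have h1 := hbound (k + 1) (fun t => Real.cos (((k + 1 : ℕ) : ℝ) * t + θ))
      fun t => Real.abs_cos_le_one _
    have h2 := hbound (k + 1) (fun t => Real.sin (((k + 1 : ℕ) : ℝ) * t + θ))
      fun t => Real.abs_sin_le_one _
    simp only [hA, hB, if_neg (Nat.succ_ne_zero k)]
    linarith
  have hfx : f = fun x => ∑' k, trigTerm A B k x := by
    funext x
    have hsx : Summable fun k => trigTerm A B k x :=
      Summable.of_norm_bounded hAB fun k => abs_trigTerm_le A B k x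
    rw [hsx.tsum_eq_zero_add, hf x]
    congr 1
    · simp [trigTerm, hA]
    · have h := hasSum_integral_mul hφ (G := fun k t => ψ (k + 1) *
        Real.cos (((k + 1 : ℕ) : ℝ) * (x - t) - θ)) ((summable_nat_add_iff 1).2 hψs)
        (fun k => by fun_prop) (fun k t => hK (k + 1) x t)
      simp_rw [hterm _ (Nat.succ_ne_zero _)]
      rw [tsum_mul_left, h.tsum_eq]
      simp only [poissonKernel, hψ, hθ]
      push_cast
      rfl
  rw [hfx, tsum_trigTerm_sub_fourierSum hAB hn]
  have hterm' : ∀ j, trigTerm A B (n + j) x = _ := fun j => hterm (n + j) (by omega) x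
  simp_rw [hterm']
  rw [tsum_mul_left]
  congr 1
  have h := hasSum_integral_mul hφ (G := fun j t => ψ (n + j) *
    Real.cos (((n + j : ℕ) : ℝ) * (x - t) - θ)) (M := fun j => ψ (n + j))
    (by simpa only [add_comm n] using (summable_nat_add_iff n).2 hψs)
    (fun k => by fun_prop) (fun k t => hK (n + k) x t)
  rw [h.tsum_eq, ← intervalIntegral.integral_const_mul]
  congr 1
  funext t
  rw [← (hasSum_modTail hs θ (x - t)).tsum_eq, ← mul_assoc, ← tsum_mul_left]
  congr 1
  refine tsum_congr fun j => ?_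
  rw [← mul_assoc, exp_mul_expRatio]
  simp only [hψ]
  push_cast
  rfl

/-! ### The upper bound by Hölder duality. -/

/-- Reconciles `periodNorm`, taken over [0, 2π), with the integrals over (-π, π] that define the
class. -/
lemma setLIntegral_period {F : ℝ → ENNReal} (hF : Function.Periodic F (2 * Real.pi)) :
    ∫⁻ t in Ico 0 (2 * Real.pi), F t = ∫⁻ t in Ioc (-Real.pi) Real.pi, F t := by
  have hT : 0 < 2 * Real.pi := by positivity
  have : VAddInvariantMeasure (AddSubgroup.zmultiples (2 * Real.pi)) ℝ volume :=
    ⟨fun c s _ => measure_preimage_add _ _ _⟩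
  have h := (isAddFundamentalDomain_Ioc hT 0).setLIntegral_eq (isAddFundamentalDomain_Ioc hT
    (-Real.pi)) F hF.map_vadd_zmultiples
  rw [zero_add, show -Real.pi + 2 * Real.pi = Real.pi by ring] at h
  rw [← h]
  exact setLIntegral_congr Ico_ae_eq_Ioc

lemma periodNorm_eq_eLpNorm {f : ℝ → ℝ} (hf : Function.Periodic f (2 * Real.pi)) {s : ENNReal}
    (hs0 : s ≠ 0) (hs : s ≠ ⊤) : periodNorm f s = eLpNorm f s periodMeasure := by
  rw [periodNorm, eLpNorm_eq_lintegral_rpow_enorm_toReal hs0 hs,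
    eLpNorm_eq_lintegral_rpow_enorm_toReal hs0 hs, setLIntegral_period]
  intro t
  simp only [hf t]

lemma perMem_of_periodNorm_le {p : ℝ} (hp : 1 < p) {φ : ℝ → ℝ}
    (hφ : φ ∈ unitBallZero (ENNReal.ofReal p)) : PerMem p φ ∧ perNorm p φ ≤ 1 := by
  obtain ⟨h1, h2, h3, -⟩ := hφ
  rw [periodNorm_eq_eLpNorm h1 (by simp; linarith) ENNReal.ofReal_ne_top] at h3
  refine ⟨⟨h2.restrict, h3.trans_lt ENNReal.one_lt_top⟩, ?_⟩
  rw [perNorm, ← toReal_eLpNorm h2.restrict]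
  exact ENNReal.toReal_le_of_le_ofReal zero_le_one (by simpa using h3)

lemma integrable_of_perMem {p : ℝ} (hp : 1 < p) {φ : ℝ → ℝ} (hφ : PerMem p φ) :
    Integrable φ periodMeasure :=
  hφ.integrable (one_le_ofReal hp)

lemma abs_integral_mul_le {p q : ℝ} (hpq : q.HolderConjugate p) {f g : ℝ → ℝ} (hf : PerMem q f)
    (hg : PerMem p g) :
    |∫ t in (-Real.pi)..Real.pi, f t * g t| ≤ perNorm q f * perNorm p g := by
  have h := integral_mul_norm_le_Lp_mul_Lq hpq hf hg
  rw [perNorm_eq hpq.pos hf.1, perNorm_eq hpq.symm.pos hg.1]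
  simp_rw [integral_periodMeasure] at h
  have h0 := norm_integral_le_integral_norm (μ := periodMeasure) fun t => f t * g t
  simp_rw [norm_mul, integral_periodMeasure] at h0
  exact h0.trans h

lemma integral_period_comp_sub_left {F : ℝ → ℝ} (hF : Function.Periodic F (2 * Real.pi)) (x : ℝ) :
    ∫ t in (-Real.pi)..Real.pi, F (x - t) = ∫ t in (-Real.pi)..Real.pi, F t := by
  rw [intervalIntegral.integral_comp_sub_left]
  have h := hF.intervalIntegral_add_eq (x - Real.pi) (-Real.pi)
  rwa [show x - Real.pi + 2 * Real.pi = x - -Real.pi by ring,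
    show -Real.pi + 2 * Real.pi = Real.pi by ring] at h

lemma tailKernel_periodic (α r : ℝ) (n : ℕ) :
    Function.Periodic (tailKernel α r n) (2 * Real.pi) := by
  intro t
  have : Complex.exp (((t + 2 * Real.pi : ℝ) : ℂ) * Complex.I) = Complex.exp (t * Complex.I) := by
    rw [← Complex.exp_periodic (t * Complex.I)]
    push_cast
    ring_nf
  rw [tailKernel, tailKernel, this]

lemma exp_nat_mul_sub_mul_I_add_two_pi (n : ℕ) (t θ : ℝ) :
    Complex.exp ((n * (t + 2 * Real.pi) - θ : ℝ) * Complex.I) =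
      Complex.exp ((n * t - θ : ℝ) * Complex.I) := by
  rw [← (Complex.exp_periodic.nat_mul n) (((n * t - θ : ℝ) : ℂ) * Complex.I)]
  push_cast
  ring_nf

lemma modTail_periodic (α r θ : ℝ) (n : ℕ) :
    Function.Periodic (modTail α r θ n) (2 * Real.pi) := by
  intro t
  rw [modTail, modTail, exp_nat_mul_sub_mul_I_add_two_pi, tailKernel_periodic]

lemma modBlock_periodic (a θ : ℝ) {n : ℕ} (hn : 1 ≤ n) :
    Function.Periodic (modBlock a θ n) (2 * Real.pi) := by
  intro t
  rw [modBlock, modBlock, exp_nat_mul_sub_mul_I_add_two_pi, blockKernel, blockKernel,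
    blockIndex_add, geomKernel_block_add a hn]

lemma abs_modTail_le {α r : ℝ} {n : ℕ} (hs : Summable (expRatio α r n)) (θ t : ℝ) :
    |modTail α r θ n t| ≤ ∑' j, expRatio α r n j :=
  (abs_exp_mul_I_mul_re_le _ _).trans (norm_tailKernel_le hs t)

lemma perNorm_comp_sub_left {q : ℝ} (hq : 0 < q) {F : ℝ → ℝ}
    (hF : Function.Periodic F (2 * Real.pi)) (hc : Continuous F) (x : ℝ) :
    perNorm q (fun t => F (x - t)) = perNorm q F := by
  rw [perNorm_eq hq (Continuous.aestronglyMeasurable (by fun_prop)),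
    perNorm_eq hq hc.aestronglyMeasurable, integral_period_comp_sub_left (F := fun t => ‖F t‖ ^ q)]
  intro t
  simp only [hF t]

lemma abs_convolution_le {α r p q : ℝ} (hpq : q.HolderConjugate p) {n : ℕ}
    (hs : Summable (expRatio α r n)) (θ : ℝ) {φ : ℝ → ℝ} (hφ : PerMem p φ)
    (hφ1 : perNorm p φ ≤ 1) (x : ℝ) :
    |∫ t in (-Real.pi)..Real.pi, modTail α r θ n (x - t) * φ t| ≤
      perNorm q (modTail α r θ n) := by
  have hc := continuous_modTail hs θ
  have h1 : PerMem q (fun t => modTail α r θ n (x - t)) :=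
    perMem_of_bound (Continuous.aestronglyMeasurable (by fun_prop)) _
      fun t => abs_modTail_le hs θ _
  refine (abs_integral_mul_le hpq h1 hφ).trans ?_
  rw [perNorm_comp_sub_left hpq.pos (modTail_periodic α r θ n) hc]
  exact mul_le_of_le_one_right lpNorm_nonneg hφ1

lemma fourierError_le {α r β p q : ℝ} (hp : 1 < p) (hpq : q.HolderConjugate p) {n : ℕ}
    (hn : 1 ≤ n) (hs : Summable (expRatio α r n)) :
    fourierError n α r β (ENNReal.ofReal p) ⊤ ≤ ENNReal.ofReal (1 / Real.pi *
      (Real.exp (-α * (n : ℝ) ^ r) * perNorm q (modTail α r (β * Real.pi / 2) n))) := by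
  refine iSup₂_le fun f hf => ?_
  obtain ⟨a₀, φ, hφ, hfx⟩ := hf
  obtain ⟨h1, h2⟩ := perMem_of_periodNorm_le hp hφ
  rw [periodNorm, eLpNorm_exponent_top]
  refine eLpNormEssSup_le_of_ae_bound (Filter.Eventually.of_forall fun x => ?_)
  rw [sub_fourierSum_eq hn hs (integrable_of_perMem hp h1) hfx, Real.norm_eq_abs, abs_mul, abs_mul,
    abs_of_pos (Real.exp_pos _), abs_of_pos (by positivity : 0 < 1 / Real.pi)]
  gcongr
  exact abs_convolution_le hpq hs _ h1 h2 x

/-! ### The lower bound by the extremal function. -/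

/-- By continuity a value above the essential supremum would be exceeded on a nonempty open set. The
point π is chosen interior to [0, 2π). -/
lemma enorm_le_periodNorm_top {R : ℝ → ℝ} (hR : Continuous R) :
    ‖R Real.pi‖ₑ ≤ periodNorm R ⊤ := by
  by_contra! h
  rw [periodNorm, eLpNorm_exponent_top] at h
  set M := eLpNormEssSup R (volume.restrict (Ico 0 (2 * Real.pi))) with hM
  have hae : ∀ᵐ y ∂volume.restrict (Ico 0 (2 * Real.pi)), ‖R y‖ₑ ≤ M := ae_le_eLpNormEssSup
  have hopen : IsOpen ({y | M < ‖R y‖ₑ} ∩ Ioo 0 (2 * Real.pi)) :=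
    (isOpen_lt continuous_const hR.enorm).inter isOpen_Ioo
  have hne : ({y | M < ‖R y‖ₑ} ∩ Ioo 0 (2 * Real.pi)).Nonempty :=
    ⟨Real.pi, h, Real.pi_pos, by linarith [Real.pi_pos]⟩
  have hpos := hopen.measure_pos volume hne
  rw [ae_restrict_iff' measurableSet_Ico] at hae
  have hz : volume ({y | M < ‖R y‖ₑ} ∩ Ioo 0 (2 * Real.pi)) = 0 := by
    refine measure_mono_null ?_ (ae_iff.1 hae)
    rintro y ⟨hy1, hy2⟩
    simp only [mem_ofPred_eq, not_forall, not_le]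
    exact ⟨Ioo_subset_Ico_self hy2, hy1⟩
  exact hpos.ne' hz

lemma continuous_convolution {α r : ℝ} {n : ℕ} (hs : Summable (expRatio α r n)) (θ : ℝ)
    {φ : ℝ → ℝ} (hφ : Integrable φ periodMeasure) :
    Continuous fun x => ∫ t in (-Real.pi)..Real.pi, modTail α r θ n (x - t) * φ t := by
  have hle : -Real.pi ≤ Real.pi := by linarith [Real.pi_pos]
  have hc := continuous_modTail hs θ
  refine intervalIntegral.continuous_of_dominated_interval
    (bound := fun t => (∑' j, expRatio α r n j) * ‖φ t‖) (fun x => ?_)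
    (fun x => Filter.Eventually.of_forall fun t _ => ?_) ?_
    (Filter.Eventually.of_forall fun t _ => by fun_prop)
  · rw [uIoc_of_le hle]
    exact (Continuous.aestronglyMeasurable (by fun_prop)).mul hφ.1
  · rw [norm_mul]
    exact mul_le_mul_of_nonneg_right (abs_modTail_le hs θ _) (norm_nonneg _)
  · rw [intervalIntegrable_iff_integrableOn_Ioc_of_le hle]
    exact hφ.norm.const_mul _

/-- The function extremal for the sampled kernel. -/
noncomputable def extremal (a q θ : ℝ) (n : ℕ) (s : ℝ) : ℝ :=
  modBlock a θ n s * |modBlock a θ n s| ^ (q - 2) / perNorm q (modBlock a θ n) ^ (q - 1)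

lemma extremal_periodic (a q θ : ℝ) {n : ℕ} (hn : 1 ≤ n) :
    Function.Periodic (extremal a q θ n) (2 * Real.pi) := by
  intro s
  rw [extremal, extremal, modBlock_periodic a θ hn]

lemma measurable_extremal {a : ℝ} (ha : 0 < a) (q θ : ℝ) (n : ℕ) :
    Measurable (extremal a q θ n) :=
  ((measurable_mul_abs_rpow q).comp (measurable_modBlock ha θ n)).div_const _

lemma integral_extremal {a q : ℝ} (hq : 1 < q) (θ : ℝ) {n : ℕ} (hn : 1 ≤ n) :
    ∫ s in (-Real.pi)..Real.pi, extremal a q θ n s = 0 := by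
  simp only [extremal]
  rw [intervalIntegral.integral_div, integral_modBlock_mul_abs_rpow hq a θ hn, zero_div]

lemma integral_abs_modBlock_eq {a q : ℝ} (ha : 0 < a) (hq : 1 < q) (θ : ℝ) (n : ℕ) :
    ∫ s in (-Real.pi)..Real.pi, |modBlock a θ n s| ^ q = perNorm q (modBlock a θ n) ^ q := by
  have h0 : 0 ≤ ∫ s in (-Real.pi)..Real.pi, |modBlock a θ n s| ^ q :=
    intervalIntegral.integral_nonneg (by linarith [Real.pi_pos]) fun _ _ => by positivity
  rw [perNorm_eq (by linarith) (measurable_modBlock ha θ n).aestronglyMeasurable]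
  simp_rw [Real.norm_eq_abs]
  rw [← Real.rpow_mul h0, one_div_mul_cancel (by linarith), Real.rpow_one]

lemma integral_modBlock_mul_extremal {a q : ℝ} (ha : 0 < a) (hq : 1 < q) (θ : ℝ) (n : ℕ)
    (hN : 0 < perNorm q (modBlock a θ n)) :
    ∫ s in (-Real.pi)..Real.pi, modBlock a θ n s * extremal a q θ n s =
      perNorm q (modBlock a θ n) := by
  simp only [extremal, ← mul_div_assoc, mul_mul_abs_rpow hq]
  rw [intervalIntegral.integral_div, integral_abs_modBlock_eq ha hq, ← Real.rpow_sub hN]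
  simp

lemma integral_abs_extremal {a p q : ℝ} (ha : 0 < a) (hpq : q.HolderConjugate p) (θ : ℝ) (n : ℕ)
    (hN : 0 < perNorm q (modBlock a θ n)) :
    ∫ s in (-Real.pi)..Real.pi, |extremal a q θ n s| ^ p = 1 := by
  have hq := hpq.lt
  have h1 : ∀ s, |extremal a q θ n s| ^ p =
      |modBlock a θ n s| ^ q / perNorm q (modBlock a θ n) ^ q := by
    intro s
    have e : (q - 1) * p = q := hpq.sub_one_mul_conj
    rw [extremal, abs_div, abs_mul_abs_rpow hq, abs_of_nonneg (Real.rpow_nonneg hN.le _),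
      Real.div_rpow (by positivity) (by positivity), ← Real.rpow_mul (abs_nonneg _),
      ← Real.rpow_mul hN.le, e]
  simp_rw [h1]
  rw [intervalIntegral.integral_div, integral_abs_modBlock_eq ha hq, div_self]
  exact (Real.rpow_pos_of_pos hN q).ne'

lemma abs_extremal_le {a q : ℝ} (ha : 0 < a) (hq : 1 < q) (θ : ℝ) (n : ℕ)
    (hN : 0 < perNorm q (modBlock a θ n)) (t : ℝ) :
    |extremal a q θ n t| ≤
      (1 - Real.exp (-a))⁻¹ ^ (q - 1) / perNorm q (modBlock a θ n) ^ (q - 1) := by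
  rw [extremal, abs_div, abs_mul_abs_rpow hq, abs_of_nonneg (Real.rpow_nonneg hN.le _)]
  have := Real.rpow_le_rpow (abs_nonneg _) (abs_modBlock_le ha θ n t) (by linarith : 0 ≤ q - 1)
  gcongr

lemma perMem_extremal {a q : ℝ} (ha : 0 < a) (hq : 1 < q) (p θ : ℝ) (n : ℕ)
    (hN : 0 < perNorm q (modBlock a θ n)) : PerMem p (extremal a q θ n) := by
  exact perMem_of_bound (measurable_extremal ha q θ n).aestronglyMeasurable _
    (abs_extremal_le ha hq θ n hN)

lemma extremal_mem_unitBallZero {a p q : ℝ} (ha : 0 < a) (hpq : q.HolderConjugate p) (θ : ℝ)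
    {n : ℕ} (hn : 1 ≤ n) (hN : 0 < perNorm q (modBlock a θ n)) :
    (fun t => extremal a q θ n (Real.pi - t)) ∈ unitBallZero (ENNReal.ofReal p) := by
  have hp := hpq.symm.lt
  have hper : Function.Periodic (fun t => extremal a q θ n (Real.pi - t)) (2 * Real.pi) := by
    intro t
    simp only
    rw [← extremal_periodic a q θ hn (Real.pi - (t + 2 * Real.pi))]
    congr 1
    ring
  have hm : Measurable fun t => extremal a q θ n (Real.pi - t) :=
    (measurable_extremal ha q θ n).comp (by fun_prop)
  refine ⟨hper, hm.aestronglyMeasurable, ?_, ?_⟩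
  · have h1 : PerMem p fun t => extremal a q θ n (Real.pi - t) :=
      perMem_of_bound hm.aestronglyMeasurable _ fun t => abs_extremal_le ha hpq.lt θ n hN _
    rw [periodNorm_eq_eLpNorm hper (by simp; linarith) ENNReal.ofReal_ne_top,
      ← ofReal_lpNorm h1]
    have h2 := perNorm_eq (q := p) (by linarith) h1.1
    rw [integral_period_comp_sub_left (F := fun t => ‖extremal a q θ n t‖ ^ p)] at h2
    · simp_rw [Real.norm_eq_abs] at h2
      rw [integral_abs_extremal ha hpq θ n hN, Real.one_rpow] at h2
      exact ENNReal.ofReal_le_one.2 h2.le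
    · intro t
      simp only [extremal_periodic a q θ hn t]
  · rw [intervalIntegral.integral_comp_sub_left, sub_zero,
      show Real.pi - 2 * Real.pi = -Real.pi by ring]
    exact integral_extremal hpq.lt θ hn

/-- At x = π, pairing D with the extremal function of g gives ‖g‖_q plus the pairing of D - g with
it, which Hölder bounds by ‖D - g‖_q. -/
lemma le_fourierError {α r β p q a : ℝ} (ha : 0 < a) (hpq : q.HolderConjugate p) {n : ℕ}
    (hn : 1 ≤ n) (hs : Summable (expRatio α r n)) :
    ENNReal.ofReal (1 / Real.pi * (Real.exp (-α * (n : ℝ) ^ r) *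
      (perNorm q (modBlock a (β * Real.pi / 2) n) -
        perNorm q (modTail α r (β * Real.pi / 2) n - modBlock a (β * Real.pi / 2) n)))) ≤
      fourierError n α r β (ENNReal.ofReal p) ⊤ := by
  set θ := β * Real.pi / 2 with hθ
  set D := modTail α r θ n with hD
  set g := modBlock a θ n with hg
  -- If g has norm zero the normalised extremal function is not available, but then the left side is
  -- nonpositive.
  rcases (lpNorm_nonneg (f := g) (p := ENNReal.ofReal q) (μ := periodMeasure)).eq_or_lt' with h | hN
  · rw [ENNReal.ofReal_of_nonpos]
    · exact zero_le
    · have h1 : 0 ≤ perNorm q (D - g) := lpNorm_nonneg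
      have h2 : 0 ≤ 1 / Real.pi := by positivity
      have h3 : perNorm q g - perNorm q (D - g) ≤ 0 := by
        rw [perNorm, h]
        linarith
      exact mul_nonpos_of_nonneg_of_nonpos h2
        (mul_nonpos_of_nonneg_of_nonpos (Real.exp_pos _).le h3)
  have hq := hpq.lt
  have hp := hpq.symm.lt
  -- The reflection about π turns the convolution at x = π into an integral of D against the
  -- extremal function itself.
  set φ : ℝ → ℝ := fun t => extremal a q θ n (Real.pi - t) with hφ
  have hmem : φ ∈ unitBallZero (ENNReal.ofReal p) := extremal_mem_unitBallZero ha hpq θ hn hN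
  obtain ⟨hφp, -⟩ := perMem_of_periodNorm_le hp hmem
  have hφi := integrable_of_perMem hp hφp
  set f : ℝ → ℝ := fun x => 0 / 2 +
    1 / Real.pi * ∫ t in (-Real.pi)..Real.pi, poissonKernel α r β (x - t) * φ t with hf
  have hfm : f ∈ poissonClass α r β (ENNReal.ofReal p) := ⟨0, φ, hmem, fun x => rfl⟩
  have hR := sub_fourierSum_eq hn hs hφi (f := f) (a₀ := 0) fun x => rfl
  rw [← hθ, ← hD] at hR
  have hRc : Continuous fun x => f x - fourierSum (n - 1) f x := by
    simp_rw [hR]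
    exact ((continuous_convolution hs θ hφi).const_mul _).const_mul _
  refine le_trans ?_ (le_iSup₂_of_le f hfm (enorm_le_periodNorm_top hRc))
  rw [Real.enorm_eq_ofReal_abs]
  refine ENNReal.ofReal_le_ofReal (le_trans ?_ (le_abs_self _))
  rw [hR]
  gcongr
  have hper : Function.Periodic (fun s => D s * extremal a q θ n s) (2 * Real.pi) := by
    intro s
    simp only
    rw [extremal_periodic a q θ hn, hD, modTail_periodic]
  have h1 := integral_period_comp_sub_left hper Real.pi
  have h2 : ∫ t in (-Real.pi)..Real.pi, D (Real.pi - t) * φ t =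
      ∫ s in (-Real.pi)..Real.pi, D s * extremal a q θ n s := h1
  have hDm : PerMem q D := perMem_modTail hs θ q
  have hgm : PerMem q g := perMem_modBlock ha θ n q
  have hem : PerMem p (extremal a q θ n) := perMem_extremal ha hq p θ n hN
  have hei := integrable_of_perMem hp hem
  have hgi : Integrable (fun s => g s * extremal a q θ n s) periodMeasure :=
    hei.bdd_mul hgm.1 (Filter.Eventually.of_forall (abs_modBlock_le ha θ n))
  have hDi : Integrable (fun s => D s * extremal a q θ n s) periodMeasure :=
    hei.bdd_mul hDm.1 (Filter.Eventually.of_forall (abs_modTail_le hs θ))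
  have h3 : ∫ s in (-Real.pi)..Real.pi, (D - g) s * extremal a q θ n s =
      (∫ s in (-Real.pi)..Real.pi, D s * extremal a q θ n s) - perNorm q g := by
    rw [← integral_modBlock_mul_extremal ha hq θ n hN]
    simp_rw [← integral_periodMeasure, Pi.sub_apply, sub_mul]
    exact integral_sub hDi hgi
  have h4 : perNorm p (extremal a q θ n) = 1 := by
    rw [perNorm_eq (by linarith) hem.1]
    simp_rw [Real.norm_eq_abs]
    rw [integral_abs_extremal ha hpq θ n hN, Real.one_rpow]
  have h5 := abs_integral_mul_le hpq (hDm.sub hgm) hem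
  rw [h4, mul_one, h3] at h5
  rw [h2]
  linarith [(abs_le.1 h5).1]

lemma toReal_periodNorm_cos {q : ℝ} (hq : 0 < q) :
    (periodNorm Real.cos (ENNReal.ofReal q)).toReal =
      (∫ x in (0 : ℝ)..(2 * Real.pi), |Real.cos x| ^ q) ^ (1 / q) := by
  rw [periodNorm, toReal_eLpNorm Real.continuous_cos.aestronglyMeasurable,
    lpNorm_eq_integral_norm_rpow_toReal (by simpa using hq) ENNReal.ofReal_ne_top
      Real.continuous_cos.aestronglyMeasurable, ENNReal.toReal_ofReal hq.le,
    integral_Ico_eq_integral_Ioc, ← intervalIntegral.integral_of_le (by positivity), one_div]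
  rfl

/-! ### The threshold, the sum of the errors and the final constants. -/

/-- Makes the infimum in `nZero` attained; `sInf` of an empty set of naturals would be 0 and carry
no information. -/
lemma exists_threshold {α r p : ℝ} (hr0 : 0 < r) (hr1 : r < 1) (hp : 1 < p) :
    ∃ n : ℕ, 1 ≤ n ∧ 1 / (α * r) * (1 / (n : ℝ) ^ r) + α * r * p / (n : ℝ) ^ (1 - r) ≤
      1 / (3 * Real.pi) ^ 3 * ((p - 1) / p) := by
  have h1 : Filter.Tendsto (fun n : ℕ => (n : ℝ) ^ r) Filter.atTop Filter.atTop :=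
    (tendsto_rpow_atTop hr0).comp tendsto_natCast_atTop_atTop
  have h2 : Filter.Tendsto (fun n : ℕ => (n : ℝ) ^ (1 - r)) Filter.atTop Filter.atTop :=
    (tendsto_rpow_atTop (by linarith)).comp tendsto_natCast_atTop_atTop
  have h3 := ((h1.const_div_atTop 1).const_mul (1 / (α * r))).add
    (h2.const_div_atTop (α * r * p))
  rw [mul_zero, add_zero] at h3
  have hpos : 0 < 1 / (3 * Real.pi) ^ 3 * ((p - 1) / p) := by
    have : 0 < p - 1 := by linarith
    positivity
  obtain ⟨n, hn, hn1⟩ := ((h3.eventually_le_const hpos).and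
    (Filter.eventually_ge_atTop 1)).exists
  exact ⟨n, hn1, hn⟩

/-- Both terms of the threshold condition decrease in n, so it persists beyond `nZero`; of the small
right-hand side only the bound 1/2 is kept. -/
lemma small_of_nZero_le {α r p : ℝ} (hα : 0 < α) (hr0 : 0 < r) (hr1 : r < 1) (hp : 1 < p) {n : ℕ}
    (hn : nZero α r p ≤ n) :
    1 ≤ n ∧ 1 / (α * r * (n : ℝ) ^ r) + α * r * (n : ℝ) ^ (r - 1) * p ≤ 1 / 2 := by
  have hmem : nZero α r p ∈ {n : ℕ | 1 ≤ n ∧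
      1 / (α * r) * (1 / (n : ℝ) ^ r) + α * r * p / (n : ℝ) ^ (1 - r) ≤
        1 / (3 * Real.pi) ^ 3 * ((p - 1) / p)} := Nat.sInf_mem (exists_threshold hr0 hr1 hp)
  obtain ⟨h1, h2⟩ := hmem
  set m := nZero α r p
  have hm' : (0 : ℝ) < m := by exact_mod_cast h1
  have hmn : (m : ℝ) ≤ n := by exact_mod_cast hn
  have hn' : (0 : ℝ) < n := hm'.trans_le hmn
  refine ⟨h1.trans hn, ?_⟩
  have h3 : 1 / (3 * Real.pi) ^ 3 * ((p - 1) / p) ≤ 1 / 2 * 1 := by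
    have h4 : (p - 1) / p ≤ 1 := by
      rw [div_le_one (by linarith)]
      linarith
    have h5 : (2 : ℝ) ≤ (3 * Real.pi) ^ 3 := by
      have : (3 : ℝ) ^ 3 ≤ (3 * Real.pi) ^ 3 := by
        gcongr
        linarith [Real.pi_gt_three]
      linarith
    have h6 : 0 ≤ (p - 1) / p := div_nonneg (by linarith) (by linarith)
    gcongr
  have h7 : 1 / (α * r * (n : ℝ) ^ r) ≤ 1 / (α * r) * (1 / (m : ℝ) ^ r) := by
    rw [one_div_mul_one_div]
    gcongr
  have h8 : α * r * (n : ℝ) ^ (r - 1) * p ≤ α * r * p / (m : ℝ) ^ (1 - r) := by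
    have e : (n : ℝ) ^ (r - 1) = ((n : ℝ) ^ (1 - r))⁻¹ := by
      rw [← Real.rpow_neg hn'.le, neg_sub]
    have e2 : α * r * (n : ℝ) ^ (r - 1) * p = α * r * p / (n : ℝ) ^ (1 - r) := by
      rw [e]
      ring
    rw [e2]
    have : 0 ≤ 1 - r := by linarith
    gcongr
  linarith

/-- Here NG, Ng, Nd stand for the norms of the geometric kernel, of g and of D - g; T is the
truncation error and 2U bounds the leading term. In the products, ε·U stays as a remainder term
while a·U ≤ 1 is absorbed in the constant. -/
lemma abs_sub_le_of_budget {a ε U T NG Ng Nd L Y : ℝ} (ha : 0 ≤ a) (hε : 0 ≤ ε) (hU : 0 ≤ U)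
    (hT : 0 ≤ T) (hsmall : a + ε ≤ 1 / 2) (haU : a * U ≤ 1) (hNG : NG ≤ 2 * U + 18 * Real.pi)
    (hd : Nd ≤ (a + (2 + 2 * Real.pi) * ε) * NG)
    (hg : |Ng - L| ≤ 2 * Real.pi * ε * NG + 18 * Real.pi + 4 * T) (hY : |Y - Ng| ≤ Nd) :
    |Y - L| ≤ Real.pi * (480 * (1 + T + ε * U)) := by
  have hpi3 := Real.pi_gt_three
  have hpi4 := Real.pi_lt_d2
  have hc : 0 ≤ a + (2 + 4 * Real.pi) * ε := by positivity
  -- 2 + 4π ≤ 15 and a + ε ≤ 1/2.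
  have hc1 : a + (2 + 4 * Real.pi) * ε ≤ 15 / 2 := by
    have h1 : (2 + 4 * Real.pi) * ε ≤ 15 * ε := by
      gcongr
      linarith
    linarith
  have hprod : (a + (2 + 4 * Real.pi) * ε) * NG ≤
      2 * 1 + (4 + 8 * Real.pi) * (ε * U) + 15 / 2 * (18 * Real.pi) := by
    calc (a + (2 + 4 * Real.pi) * ε) * NG ≤
        (a + (2 + 4 * Real.pi) * ε) * (2 * U + 18 * Real.pi) := by gcongr
      _ = 2 * (a * U) + (4 + 8 * Real.pi) * (ε * U) +
          (a + (2 + 4 * Real.pi) * ε) * (18 * Real.pi) := by ring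
      _ ≤ _ := by gcongr
  have hεU : ε * U ≤ Real.pi * (ε * U) := le_mul_of_one_le_left (by positivity) (by linarith)
  have hπT : T ≤ Real.pi * T := le_mul_of_one_le_left hT (by linarith)
  have htri := abs_sub_le Y Ng L
  have hεU0 : 0 ≤ Real.pi * (ε * U) := by positivity
  linarith

/-- Explicit two-sided bounds for the error of approximation by Fourier sums. -/
lemma abs_fourierError_sub_le {α r β p q : ℝ} (hα : 0 < α) (hr0 : 0 < r) (hr1 : r < 1)
    (hpq : q.HolderConjugate p) {n : ℕ} (hn : 1 ≤ n)
    (hsmall : 1 / (α * r * (n : ℝ) ^ r) + α * r * (n : ℝ) ^ (r - 1) * p ≤ 1 / 2) :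
    fourierError n α r β (ENNReal.ofReal p) ⊤ ≠ ⊤ ∧
    |(fourierError n α r β (ENNReal.ofReal p) ⊤).toReal / Real.exp (-α * (n : ℝ) ^ r) -
        cosMean q * leadingTerm (α * r * (n : ℝ) ^ (r - 1)) q / Real.pi| ≤
      480 * (1 + (α * r) ^ ((q - 1) / p) / (q - 1) + 1 / (α * r * (n : ℝ) ^ r) *
        ((α * r * (n : ℝ) ^ (r - 1)) ^ (-(1 / p)) * p ^ (1 / q))) := by
  have hq := hpq.lt
  have hp := hpq.symm.lt
  have hn' : (0 : ℝ) < n := by exact_mod_cast hn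
  have ha : 0 < α * r * (n : ℝ) ^ (r - 1) := by positivity
  have hε : 0 < 1 / (α * r * (n : ℝ) ^ r) := by positivity
  have hap : 0 < α * r * (n : ℝ) ^ (r - 1) * p := by positivity
  have ha_le : α * r * (n : ℝ) ^ (r - 1) ≤ α * r * (n : ℝ) ^ (r - 1) * p :=
    le_mul_of_one_le_right ha.le hp.le
  have hs := summable_expRatio hα hr0 hr1 hn (by linarith)
  have hna : (n : ℝ) * (α * r * (n : ℝ) ^ (r - 1)) = α * r * (n : ℝ) ^ r := by
    rw [Real.rpow_sub_one hn'.ne']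
    field_simp
  have haα : α * r * (n : ℝ) ^ (r - 1) ≤ α * r := by
    refine mul_le_of_le_one_right (by positivity) ?_
    exact Real.rpow_le_one_of_one_le_of_nonpos (by exact_mod_cast hn) (by linarith)
  have hup := fourierError_le (β := β) hp hpq hn hs
  have hlow := le_fourierError (β := β) ha hpq hn hs
  have hd := perNorm_modTail_sub_modBlock_le (q := q) hα hr0 hr1 hn (by linarith)
    (β * Real.pi / 2)
  have hg := abs_perNorm_modBlock_sub_le ha (by linarith) hq (β * Real.pi / 2) hn
  rw [hna] at hg
  have hG := perNorm_geomKernel_le ha (by linarith) hq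
  have hL := leadingTerm_le ha hq
  have hinv : 1 - 1 / q = 1 / p := by
    have := hpq.inv_add_inv_eq_one
    rw [one_div, one_div]
    linarith
  have hpval : q / (q - 1) = p := hpq.conjugate_eq.symm
  rw [hinv, hpval] at hL
  rw [hinv] at hg
  have htri := lpNorm_le_lpNorm_add_lpNorm_sub' (p := ENNReal.ofReal q) (μ := periodMeasure)
    (f := modTail α r (β * Real.pi / 2) n)
    (perMem_modBlock ha (β * Real.pi / 2) n q) (one_le_ofReal hq)
  have hT : (α * r * (n : ℝ) ^ (r - 1)) ^ ((q - 1) * (1 / p)) / (q - 1) ≤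
      (α * r) ^ ((q - 1) / p) / (q - 1) := by
    have hq1 : 0 < q - 1 := by linarith
    rw [mul_one_div]
    gcongr
  -- The product is (ap)^{1/q}, and the factor p in the threshold condition makes ap ≤ 1/2.
  have hU : α * r * (n : ℝ) ^ (r - 1) *
      ((α * r * (n : ℝ) ^ (r - 1)) ^ (-(1 / p)) * p ^ (1 / q)) ≤ 1 := by
    have e : α * r * (n : ℝ) ^ (r - 1) *
        ((α * r * (n : ℝ) ^ (r - 1)) ^ (-(1 / p)) * p ^ (1 / q)) =
        (α * r * (n : ℝ) ^ (r - 1) * p) ^ (1 / q) := by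
      rw [Real.mul_rpow ha.le (by linarith), ← mul_assoc]
      congr 1
      rw [← Real.rpow_one_add' ha.le (by rw [← hinv]; simp; linarith), ← hinv]
      congr 1
      ring
    rw [e]
    exact Real.rpow_le_one hap.le (by linarith) (by positivity)
  have hT0 : 0 ≤ (α * r) ^ ((q - 1) / p) / (q - 1) :=
    div_nonneg (by positivity) (by linarith)
  have hU0 : 0 ≤ (α * r * (n : ℝ) ^ (r - 1)) ^ (-(1 / p)) * p ^ (1 / q) := by positivity
  have hE : 0 < Real.exp (-α * (n : ℝ) ^ r) := Real.exp_pos _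
  set e := Real.exp (-α * (n : ℝ) ^ r)
  set ε := 1 / (α * r * (n : ℝ) ^ r)
  set a := α * r * (n : ℝ) ^ (r - 1)
  set T := (α * r) ^ ((q - 1) / p) / (q - 1)
  set U := a ^ (-(1 / p)) * p ^ (1 / q)
  set Err := fourierError n α r β (ENNReal.ofReal p) ⊤
  have hfin : Err ≠ ⊤ := ne_top_of_le_ne_top ENNReal.ofReal_ne_top hup
  refine ⟨hfin, ?_⟩
  have hND : 0 ≤ perNorm q (modTail α r (β * Real.pi / 2) n) := lpNorm_nonneg
  rw [ENNReal.ofReal_le_iff_le_toReal hfin] at hlow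
  have hup' : Err.toReal ≤ _ := ENNReal.toReal_le_of_le_ofReal (by positivity) hup
  set Ng := perNorm q (modBlock a (β * Real.pi / 2) n)
  set Nd := perNorm q (modTail α r (β * Real.pi / 2) n - modBlock a (β * Real.pi / 2) n)
  set ND := perNorm q (modTail α r (β * Real.pi / 2) n)
  set NG := perNorm q (geomKernel a)
  set κL := cosMean q * leadingTerm a q
  have hx1 : Ng - Nd ≤ Err.toReal / e * Real.pi := by
    rw [div_mul_eq_mul_div, le_div_iff₀ hE]
    have e1 : 1 / Real.pi * (e * (Ng - Nd)) * Real.pi = (Ng - Nd) * e := by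
      field_simp
    rw [← e1]
    gcongr
  have hx2 : Err.toReal / e * Real.pi ≤ Ng + Nd := by
    rw [div_mul_eq_mul_div, div_le_iff₀ hE]
    have e1 : 1 / Real.pi * (e * ND) * Real.pi = ND * e := by
      field_simp
    calc Err.toReal * Real.pi ≤ 1 / Real.pi * (e * ND) * Real.pi := by gcongr
      _ = ND * e := e1
      _ ≤ (Ng + Nd) * e := by gcongr
  have hNG : NG ≤ 2 * U + 18 * Real.pi := by linarith
  have hmain : |Err.toReal / e * Real.pi - κL| ≤ Real.pi * (480 * (1 + T + ε * U)) :=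
    abs_sub_le_of_budget ha.le hε.le hU0 hT0 (by linarith) hU hNG hd
      (hg.trans (by linarith)) (abs_le.2 ⟨by linarith, by linarith⟩)
  have hfinal : Err.toReal / e - κL / Real.pi = (Err.toReal / e * Real.pi - κL) / Real.pi := by
    field_simp
  rw [hfinal, abs_div, abs_of_pos Real.pi_pos, div_le_iff₀' Real.pi_pos]
  exact hmain

/-- The factor 2^{1/q} from the two half-lines cancels the 2 in the normalisation 1/(2π) of the
cosine mean; what is left, with the 1/π of the convolution, is π^{-(1+1/q)}. -/
lemma leadingConstant_eq {α r p q : ℝ} (hα : 0 < α) (hr0 : 0 < r)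
    (hpq : q.HolderConjugate p) {n : ℕ} (hn : 1 ≤ n) :
    cosMean q * leadingTerm (α * r * (n : ℝ) ^ (r - 1)) q / Real.pi =
      (n : ℝ) ^ ((1 - r) / p) * ((periodNorm Real.cos (ENNReal.ofReal q)).toReal /
        (Real.pi ^ (1 + 1 / q) * (α * r) ^ (1 / p)) *
        (ordinaryHypergeometric (1 / 2 : ℝ) ((3 - q) / 2) (3 / 2) (1 : ℝ)) ^ (1 / q)) := by
  have hq := hpq.lt
  have hn' : (0 : ℝ) < n := by exact_mod_cast hn
  have hpi := Real.pi_pos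
  have hI : 0 ≤ tailIntegral q := le_trans (by positivity) (le_tailIntegral hq)
  have hinv : 1 - 1 / q = 1 / p := by
    have := hpq.inv_add_inv_eq_one
    rw [one_div, one_div]
    linarith
  have hC := integral_abs_cos_rpow_nonneg q
  have e1 : (α * r * (n : ℝ) ^ (r - 1)) ^ (-(1 / p)) =
      (n : ℝ) ^ ((1 - r) / p) / (α * r) ^ (1 / p) := by
    rw [Real.mul_rpow (by positivity) (by positivity), ← Real.rpow_mul hn'.le,
      Real.rpow_neg (by positivity), mul_comm, div_eq_mul_inv]
    congr 2
    ring
  rw [hypergeometric_eq_tailIntegral hq, toReal_periodNorm_cos (by linarith), leadingTerm, hinv, e1,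
    cosMean, Real.mul_rpow (by positivity) hC, Real.mul_rpow (by norm_num) hI, Real.rpow_add hpi,
    Real.rpow_one, Real.div_rpow (by norm_num) (by positivity), Real.one_rpow,
    Real.mul_rpow (by norm_num) hpi.le]
  field_simp

lemma remainder_eq {α r p q : ℝ} (hα : 0 < α) (hr0 : 0 < r)
    {n : ℕ} (hn : 1 ≤ n) (T : ℝ) :
    1 + T + 1 / (α * r * (n : ℝ) ^ r) *
        ((α * r * (n : ℝ) ^ (r - 1)) ^ (-(1 / p)) * p ^ (1 / q)) =
      (n : ℝ) ^ ((1 - r) / p) * ((1 + T) * (1 / (n : ℝ) ^ ((1 - r) / p)) +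
        p ^ (1 / q) / (α * r) ^ (1 + 1 / p) * (1 / (n : ℝ) ^ r)) := by
  have hn' : (0 : ℝ) < n := by exact_mod_cast hn
  have hαr : 0 < α * r := by positivity
  have e1 : (α * r * (n : ℝ) ^ (r - 1)) ^ (-(1 / p)) =
      (n : ℝ) ^ ((1 - r) / p) / (α * r) ^ (1 / p) := by
    rw [Real.mul_rpow (by positivity) (by positivity), ← Real.rpow_mul hn'.le,
      Real.rpow_neg (by positivity), mul_comm, div_eq_mul_inv]
    congr 2
    ring
  rw [e1, Real.rpow_add hαr, Real.rpow_one]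
  field_simp

end GenPoisson

theorem mainTheorem5 (α r β p p' : ℝ) (hr0 : 0 < r) (hr1 : r < 1) (hp : 1 < p)
    (hpp' : 1 / p + 1 / p' = 1) (hα : 0 < α) (n : ℕ)
    (hn : GenPoisson.nZero α r p ≤ n) :
    GenPoisson.fourierError n α r β (ENNReal.ofReal p) ⊤ ≠ ⊤ ∧
    ∃ γ : ℝ, |γ| ≤ (14 * Real.pi) ^ 2 ∧
      (GenPoisson.fourierError n α r β (ENNReal.ofReal p) ⊤).toReal =
        Real.exp (-α * (n : ℝ) ^ r) * (n : ℝ) ^ ((1 - r) / p) *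
          ((GenPoisson.periodNorm Real.cos (ENNReal.ofReal p')).toReal /
              (Real.pi ^ (1 + 1 / p') * (α * r) ^ (1 / p)) *
              (ordinaryHypergeometric (1 / 2 : ℝ) ((3 - p') / 2) (3 / 2) (1 : ℝ)) ^ (1 / p')
            + γ * ((1 + (α * r) ^ ((p' - 1) / p) / (p' - 1)) *
                  (1 / (n : ℝ) ^ ((1 - r) / p))
                + p ^ (1 / p') / (α * r) ^ (1 + 1 / p) * (1 / (n : ℝ) ^ r))) := by
  have hpq : p'.HolderConjugate p :=
    (Real.holderConjugate_iff.2 ⟨hp, by simpa only [one_div] using hpp'⟩).symm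
  obtain ⟨hn1, hsmall⟩ := GenPoisson.small_of_nZero_le hα hr0 hr1 hp hn
  obtain ⟨hfin, hbd⟩ :=
    GenPoisson.abs_fourierError_sub_le (β := β) hα hr0 hr1 hpq hn1 hsmall
  refine ⟨hfin, ?_⟩
  have hT0 : 0 ≤ (α * r) ^ ((p' - 1) / p) / (p' - 1) :=
    div_nonneg (by positivity) (by linarith [hpq.lt])
  have hpos : 0 < 1 + (α * r) ^ ((p' - 1) / p) / (p' - 1) + 1 / (α * r * (n : ℝ) ^ r) *
      ((α * r * (n : ℝ) ^ (r - 1)) ^ (-(1 / p)) * p ^ (1 / p')) := by positivity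
  rw [GenPoisson.leadingConstant_eq hα hr0 hpq hn1] at hbd
  set X := (GenPoisson.fourierError n α r β (ENNReal.ofReal p) ⊤).toReal
  set e := Real.exp (-α * (n : ℝ) ^ r) with he
  have he0 : 0 < e := Real.exp_pos _
  set S := 1 + (α * r) ^ ((p' - 1) / p) / (p' - 1) + 1 / (α * r * (n : ℝ) ^ r) *
      ((α * r * (n : ℝ) ^ (r - 1)) ^ (-(1 / p)) * p ^ (1 / p')) with hS
  rw [GenPoisson.remainder_eq hα hr0 hn1] at hS
  set M := (GenPoisson.periodNorm Real.cos (ENNReal.ofReal p')).toReal /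
    (Real.pi ^ (1 + 1 / p') * (α * r) ^ (1 / p)) *
    (ordinaryHypergeometric (1 / 2 : ℝ) ((3 - p') / 2) (3 / 2) (1 : ℝ)) ^ (1 / p')
  set N := (n : ℝ) ^ ((1 - r) / p)
  -- γ is defined by solving the asserted identity for it; S > 0 makes this legitimate, and `hS`
  -- identifies S with n^{(1-r)/p} times the bracket multiplying γ.
  refine ⟨(X / e - N * M) / S, ?_, ?_⟩
  · rw [abs_div, abs_of_pos hpos, div_le_iff₀ hpos]
    refine hbd.trans ?_
    gcongr
    -- 480 ≤ 14²·9 < (14π)².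
    nlinarith [Real.pi_gt_three]
  · set B := (1 + (α * r) ^ ((p' - 1) / p) / (p' - 1)) * (1 / N) +
      p ^ (1 / p') / (α * r) ^ (1 + 1 / p) * (1 / (n : ℝ) ^ r)
    have hexp : e * N * (M + (X / e - N * M) / S * B) =
        e * (N * M + (X / e - N * M) / S * (N * B)) := by ring
    rw [hexp, ← hS, div_mul_cancel₀ _ hpos.ne', add_sub_cancel, mul_div_cancel₀ _ he0.ne']
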